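/- Let $k$ be a field of characteristic different from $2$ and let $a,B,c,C\in k$. Put $$g=C+2(a-1)-\tfrac{(2-B)^2}{4},\qquad h=c-(a-1)(C+a-1).$$ Let $E$ be the elliptic-type algebra $$E=k\langle x,y,z\rangle/\langle zx-ax^2-(1-a)(2-B)xy-cy^2+xz-z^2,\ zy-x^2-Bxy-Cy^2+yz,\ xy-yx\rangle ,$$ graded by $\deg x=\deg y=\deg z=1$, and let $$T=T(g,h)=k\langle x,y,w\rangle/\langle wy+yw-x^2-gy^2,\ w^2+hy^2,\ xy-yx\rangle ,$$ graded by $\deg x=\deg y=\deg w=1$. Modules are graded left modules, $T(-j)_n=T_{n-j}$, elements of free modules are row vectors, and matrices act on them from the right. A connected graded algebra $A$ is called Koszul if the trivial module ${}_Ak=A/A_+$ has a graded projective resolution $\cdots\to P_1\to P_0\to k\to 0$ with each $P_i$ generated in degree $i$. Then: 1. $T$ is a connected graded algebra, and $E\cong T(g,h)$ as graded algebras. 2. If $h\ne 0$, then $$0\to T(-3)\xrightarrow{d_3}T(-2)^3\xrightarrow{d_2}T(-1)^3\xrightarrow{d_1}T\ (\to k\to 0),$$ $$d_3=\begin{bmatrix}hy&w&-hx\end{bmatrix},\quad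 d_2=\begin{bmatrix}-x&w-gy&y\\0&hy&w\\-y&x&0\end{bmatrix},\quad d_1=\begin{bmatrix}x\\y\\w\end{bmatrix},$$ is a resolution $Q_\bullet$ of ${}_Tk$ by graded free $T$-modules. 3. If $h=0$, then the sequence $P_\bullet$ with $P_0=T$, $P_1=T(-1)^3$, $P_2=T(-2)^3$, $P_i=T(-i)\oplus T(-i-1)$ for $i\ge 3$, and differentials $d_i:P_i\to P_{i-1}$, $$d_1=\begin{bmatrix}x\\y\\w\end{bmatrix},\ d_2=\begin{bmatrix}-x&w-gy&y\\0&0&w\\-y&x&0\end{bmatrix},\ d_3=\begin{bmatrix}0&w&0\\wy&-y^2&-wx\end{bmatrix},\ d_4=\begin{bmatrix}w&0\\y^2&w\end{bmatrix},\ d_i=\begin{bmatrix}w&0\\y^2&-w\end{bmatrix}\ (i\ge5),$$ is a resolution of ${}_Tk$ by graded free $T$-modules. 4. $T(g,h)$, equivalently $E$, is Koszul if and only if $h=c-(a-1)(C+a-1)\neq 0$. 5. $E$ is a quadratic algebra, and it is a graded twisted tensor product of the Koszul algebras $k[x,y]$ and $k[z]$ along the graded algebra homomorphisms $x\mapsto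 x,\ y\mapsto y$ and $z\mapsto z$; that is, these homomorphisms are injective and the map $k[x,y]\otimes k[z]\to E$, $r\otimes s\mapsto rs$, is bijective. Hence, when $h=0$, $E$ is a quadratic twisted tensor product of Koszul algebras that is not Koszul. -/

import Mathlib

open scoped TensorProduct

universe u v

noncomputable section

namespace KoszulTTP

/-! Graded algebras are given by a `k`-algebra `A` with the family `𝒜 : ℕ → Submodule k A` of its
homogeneous components. Modules are left modules, and they are graded by `ℤ`. -/

section Graded

variable {k : Type u} [Field k] {A : Type v} [Ring A] [Algebra k A]

/-- `A = ⨁ 𝒜 n` is a graded algebra which is connected (`A₀ = k`) and is generated by finitely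
many homogeneous elements. -/
structure IsConnectedGraded (𝒜 : ℕ → Submodule k A) : Prop where
  nontrivial : Nontrivial A
  gradedMonoid : SetLike.GradedMonoid 𝒜
  isInternal : DirectSum.IsInternal 𝒜
  connected : 𝒜 0 = 1
  finitelyGenerated : ∃ s : Finset A,
    (∀ a ∈ s, ∃ n, a ∈ 𝒜 n) ∧ Algebra.adjoin k (s : Set A) = ⊤

/-- The components `𝒜 n`, indexed by all integers `n`, with `𝒜 n = 0` for `n < 0`. -/
def intGrading (𝒜 : ℕ → Submodule k A) : ℤ → Submodule k A
  | .ofNat n => 𝒜 n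
  | .negSucc _ => ⊥

/-- `M = ⨁ ℳ n` is a (`ℤ`-)graded left `A`-module. -/
structure IsGradedModule (𝒜 : ℕ → Submodule k A) {M : Type*} [AddCommGroup M] [Module A M]
    (ℳ : ℤ → AddSubgroup M) : Prop where
  isInternal : DirectSum.IsInternal ℳ
  smul_mem : ∀ (i : ℕ) (j : ℤ) (a : A) (m : M), a ∈ 𝒜 i → m ∈ ℳ j → a • m ∈ ℳ (i + j)

/-- A graded module is generated in degree `d`. -/
def IsGeneratedInDegree (A : Type v) [Ring A] {M : Type*} [AddCommGroup M] [Module A M]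
    (ℳ : ℤ → AddSubgroup M) (d : ℤ) : Prop :=
  Submodule.span A (ℳ d : Set M) = ⊤

/-- A graded free module: a graded module with a basis of homogeneous elements. -/
def IsGradedFree (𝒜 : ℕ → Submodule k A) {M : Type*} [AddCommGroup M] [Module A M]
    (ℳ : ℤ → AddSubgroup M) : Prop :=
  IsGradedModule 𝒜 ℳ ∧
    ∃ (ι : Type v) (b : Module.Basis ι A M), ∀ i, ∃ d : ℤ, b i ∈ ℳ d

/-- `A₊ = ⨁_{n > 0} 𝒜 n`, as the left ideal generated by the components of positive degree. -/
def augIdeal (𝒜 : ℕ → Submodule k A) : Submodule A A :=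
  Submodule.span A {a | ∃ n, 0 < n ∧ a ∈ 𝒜 n}

/-- The trivial left module `A / A₊`. -/
abbrev TrivialModule (𝒜 : ℕ → Submodule k A) : Type v := A ⧸ augIdeal 𝒜

/-- The grading of the trivial module, induced by the grading of `A`. -/
def trivialGrading (𝒜 : ℕ → Submodule k A) (n : ℤ) : AddSubgroup (TrivialModule 𝒜) :=
  (intGrading 𝒜 n).toAddSubgroup.map (augIdeal 𝒜).mkQ.toAddMonoidHom

/-- `⋯ → P 2 → P 1 → P 0 → A / A₊ → 0` is an exact sequence of graded `A`-modules and
homomorphisms of degree zero. -/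
structure IsGradedResolution (𝒜 : ℕ → Submodule k A) {P : ℕ → Type*}
    [∀ i, AddCommGroup (P i)] [∀ i, Module A (P i)]
    (𝒢 : ∀ i, ℤ → AddSubgroup (P i))
    (d : ∀ i, P (i + 1) →ₗ[A] P i) (ε : P 0 →ₗ[A] TrivialModule 𝒜) : Prop where
  graded : ∀ i, IsGradedModule 𝒜 (𝒢 i)
  d_mem : ∀ i n p, p ∈ 𝒢 (i + 1) n → d i p ∈ 𝒢 i n
  ε_mem : ∀ n p, p ∈ 𝒢 0 n → ε p ∈ trivialGrading 𝒜 n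
  exact_succ : ∀ i, Function.Exact (d (i + 1)) (d i)
  exact_zero : Function.Exact (d 0) ε
  surjective : Function.Surjective ε

/-- The graded algebra `A` is Koszul: the trivial module has a graded projective resolution
`P` such that `P i` is generated in degree `i` for all `i`. -/
def IsKoszul (𝒜 : ℕ → Submodule k A) : Prop :=
  ∃ (P : ℕ → Type v) (_ : ∀ i, AddCommGroup (P i)) (_ : ∀ i, Module A (P i))
    (𝒢 : ∀ i, ℤ → AddSubgroup (P i))
    (d : ∀ i, P (i + 1) →ₗ[A] P i) (ε : P 0 →ₗ[A] TrivialModule 𝒜),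
    IsGradedResolution 𝒜 𝒢 d ε ∧ (∀ i, Module.Projective A (P i)) ∧
      ∀ i, IsGeneratedInDegree A (𝒢 i) i

/-- The graded algebra `A` is quadratic: the canonical map from the tensor algebra of `A₁` to `A`
is surjective, and its kernel is generated, as a two-sided ideal, by its elements of degree 2. -/
def IsQuadratic (𝒜 : ℕ → Submodule k A) : Prop :=
  Function.Surjective (TensorAlgebra.lift k (𝒜 1).subtype) ∧
  TwoSidedIdeal.ker (TensorAlgebra.lift k (𝒜 1).subtype) =
    TwoSidedIdeal.span {t | t ∈ LinearMap.range (TensorAlgebra.ι k (M := 𝒜 1)) ^ 2 ∧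
      TensorAlgebra.lift k (𝒜 1).subtype t = 0}

/-- `(C, iA, iB)` is a graded twisted tensor product of the graded algebras `A` and `B`. -/
structure IsGradedTwistedTensorProduct {B C : Type*} [Ring B] [Algebra k B] [Ring C] [Algebra k C]
    (𝒜 : ℕ → Submodule k A) (ℬ : ℕ → Submodule k B) (𝒞 : ℕ → Submodule k C)
    (iA : A →ₐ[k] C) (iB : B →ₐ[k] C) : Prop where
  gradedLeft : IsConnectedGraded 𝒜
  gradedRight : IsConnectedGraded ℬ
  graded : IsConnectedGraded 𝒞
  left_mem : ∀ n a, a ∈ 𝒜 n → iA a ∈ 𝒞 n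
  right_mem : ∀ n b, b ∈ ℬ n → iB b ∈ 𝒞 n
  left_injective : Function.Injective iA
  right_injective : Function.Injective iB
  /-- The map `A ⊗ B → C`, `a ⊗ b ↦ iA a * iB b`, is bijective. -/
  bijective : Function.Bijective
    (LinearMap.mul' k C ∘ₗ TensorProduct.map iA.toLinearMap iB.toLinearMap : A ⊗[k] B →ₗ[k] C)

/-- The grading of `⨁ⱼ A(-deg j)`, where `A(-d)ₙ = A_{n - d}`: the free module `ι → A` whose
`j`-th basis vector has degree `deg j`. -/
def freeGrading (𝒜 : ℕ → Submodule k A) {ι : Type*} (deg : ι → ℤ) (n : ℤ) :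
    AddSubgroup (ι → A) :=
  (Submodule.pi Set.univ fun j => intGrading 𝒜 (n - deg j)).toAddSubgroup

end Graded

section Algebras

variable {k : Type u} [Field k]

/-- The algebra `k⟨X₀, X₁, X₂⟩ / (rels)`. -/
def Presented (rels : Set (FreeAlgebra k (Fin 3))) : Type u :=
  RingQuot fun p q : FreeAlgebra k (Fin 3) => p ∈ rels ∧ q = 0

instance (rels : Set (FreeAlgebra k (Fin 3))) : Ring (Presented rels) :=
  inferInstanceAs (Ring (RingQuot fun p q : FreeAlgebra k (Fin 3) => p ∈ rels ∧ q = 0))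

instance (rels : Set (FreeAlgebra k (Fin 3))) : Algebra k (Presented rels) :=
  inferInstanceAs (Algebra k (RingQuot fun p q : FreeAlgebra k (Fin 3) => p ∈ rels ∧ q = 0))

/-- The quotient map `k⟨X₀, X₁, X₂⟩ → k⟨X₀, X₁, X₂⟩ / (rels)`. -/
def Presented.mk (rels : Set (FreeAlgebra k (Fin 3))) :
    FreeAlgebra k (Fin 3) →ₐ[k] Presented rels :=
  RingQuot.mkAlgHom k fun p q : FreeAlgebra k (Fin 3) => p ∈ rels ∧ q = 0

/-- The image of the generator `Xᵢ`. -/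
def gen (rels : Set (FreeAlgebra k (Fin 3))) (i : Fin 3) : Presented rels :=
  Presented.mk rels (FreeAlgebra.ι k i)

/-- The grading of `k⟨X₀, X₁, X₂⟩ / (rels)` with generators in degree 1: the `n`-th component is
spanned by the words of length `n`. -/
def wordGrading (rels : Set (FreeAlgebra k (Fin 3))) (n : ℕ) : Submodule k (Presented rels) :=
  Submodule.span k (Set.range (gen rels)) ^ n

/-- The relations `zx = ax² + bxy + cy² + dxz + eyz + fz²`,
`zy = Ax² + Bxy + Cy² + Dxz + Eyz + Fz²`, `xy = yx` on generators `x, y, z`. -/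
def twistedRels (a b c d e f A B C D E F : k) : Set (FreeAlgebra k (Fin 3)) :=
  let x := FreeAlgebra.ι k (0 : Fin 3)
  let y := FreeAlgebra.ι k (1 : Fin 3)
  let z := FreeAlgebra.ι k (2 : Fin 3)
  {z * x - (a • x ^ 2 + b • (x * y) + c • y ^ 2 + d • (x * z) + e • (y * z) + f • z ^ 2),
   z * y - (A • x ^ 2 + B • (x * y) + C • y ^ 2 + D • (x * z) + E • (y * z) + F • z ^ 2),
   x * y - y * x}

/-- The relations of the elliptic-type algebra
`T(a, (1 - a)(2 - B), c, -1, 0, 1; 1, B, C, 0, -1, 0)`. -/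
def ellipticRels (a c B C : k) : Set (FreeAlgebra k (Fin 3)) :=
  twistedRels a ((1 - a) * (2 - B)) c (-1) 0 1 1 B C 0 (-1) 0

/-- The relations `wy + yw - x² - gy²`, `w² + hy²`, `xy - yx` on generators `x, y, w`. -/
def weierstrassRels (g h : k) : Set (FreeAlgebra k (Fin 3)) :=
  let x := FreeAlgebra.ι k (0 : Fin 3)
  let y := FreeAlgebra.ι k (1 : Fin 3)
  let w := FreeAlgebra.ι k (2 : Fin 3)
  {w * y + y * w - x ^ 2 - g • y ^ 2, w ^ 2 + h • y ^ 2, x * y - y * x}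

/-- The algebra `T(g, h) = k⟨x, y, w⟩ / (wy + yw - x² - gy², w² + hy², xy - yx)`. -/
abbrev T (g h : k) : Type u := Presented (weierstrassRels g h)

/-- The grading of `T(g, h)`. -/
abbrev gradingT (g h : k) : ℕ → Submodule k (T g h) := wordGrading (weierstrassRels g h)

variable (g h : k)

/-- The generator `x` of `T(g, h)`. -/
def x : T g h := gen (weierstrassRels g h) 0

/-- The generator `y` of `T(g, h)`. -/
def y : T g h := gen (weierstrassRels g h) 1

/-- The generator `w` of `T(g, h)`. -/
def w : T g h := gen (weierstrassRels g h) 2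

/-- The rank of `Qᵢ`. -/
abbrev rankQ : ℕ → ℕ
  | 0 => 1
  | 1 => 3
  | 2 => 3
  | 3 => 1
  | _ + 4 => 0

/-- `Qᵢ` is generated in degree `i`: `Q₀ = T`, `Q₁ = T(-1)³`, `Q₂ = T(-2)³`, `Q₃ = T(-3)`. -/
def degQ (i : ℕ) : Fin (rankQ i) → ℤ := fun _ => i

/-- The matrix of the differential `Qᵢ₊₁ → Qᵢ`, acting on row vectors from the right. -/
def matQ : (i : ℕ) → Matrix (Fin (rankQ (i + 1))) (Fin (rankQ i)) (T g h)
  | 0 => !![x g h; y g h; w g h]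
  | 1 => !![-x g h, w g h - g • y g h, y g h;
            0, h • y g h, w g h;
            -y g h, x g h, 0]
  | 2 => !![h • y g h, w g h, -(h • x g h)]
  | _ + 3 => 0

/-- The rank of `Pᵢ`. -/
abbrev rankP : ℕ → ℕ
  | 0 => 1
  | 1 => 3
  | 2 => 3
  | _ + 3 => 2

/-- The degrees of the generators of `Pᵢ`: `P₀ = T`, `P₁ = T(-1)³`, `P₂ = T(-2)³` and
`Pᵢ = T(-i) ⊕ T(-i-1)` for `i ≥ 3`. -/
def degP : (i : ℕ) → Fin (rankP i) → ℤ
  | 0 => fun _ => 0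
  | 1 => fun _ => 1
  | 2 => fun _ => 2
  | i + 3 => ![(i : ℤ) + 3, (i : ℤ) + 4]

/-- The matrix of the differential `Pᵢ₊₁ → Pᵢ`, acting on row vectors from the right; it is used
for `h = 0`. -/
def matP : (i : ℕ) → Matrix (Fin (rankP (i + 1))) (Fin (rankP i)) (T g h)
  | 0 => !![x g h; y g h; w g h]
  | 1 => !![-x g h, w g h - g • y g h, y g h;
            0, 0, w g h;
            -y g h, x g h, 0]
  | 2 => !![0, w g h, 0;
            w g h * y g h, -(y g h) ^ 2, -(w g h * x g h)]
  | 3 => !![w g h, 0;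
            (y g h) ^ 2, w g h]
  | _ + 4 => !![w g h, 0;
                (y g h) ^ 2, -w g h]

/-- The canonical projection `T → T / T₊`, on the free module of rank one. -/
def augmentation : (Fin 1 → T g h) →ₗ[T g h] TrivialModule (gradingT g h) :=
  (augIdeal (gradingT g h)).mkQ ∘ₗ LinearMap.proj 0

/-- The complex `Q` is a resolution of the trivial `T(g, h)`-module by graded free modules. -/
def ResolutionQ : Prop :=
  IsGradedResolution (gradingT g h) (P := fun i => Fin (rankQ i) → T g h)
    (fun i => freeGrading (gradingT g h) (degQ i))
    (fun i => (matQ g h i).vecMulLinear) (augmentation g h) ∧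
  ∀ i, IsGradedFree (gradingT g h) (freeGrading (gradingT g h) (degQ i))

/-- The complex `P` is a resolution of the trivial `T(g, h)`-module by graded free modules. -/
def ResolutionP : Prop :=
  IsGradedResolution (gradingT g h) (P := fun i => Fin (rankP i) → T g h)
    (fun i => freeGrading (gradingT g h) (degP i))
    (fun i => (matP g h i).vecMulLinear) (augmentation g h) ∧
  ∀ i, IsGradedFree (gradingT g h) (freeGrading (gradingT g h) (degP i))

end Algebras

end KoszulTTP

end

/-! The linear substitution behind `ellipticEquivT` completes squares and turns E into T, so
everything is computed in T. The main structural fact is that T is free as a left module over a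
polynomial ring. Put z = w + x + r y for any scalar r. The element w itself is unsuitable, since w²
is a multiple of y². The relation for w² becomes zx + xz = z² + p, and the one for wy + yw becomes
zy + yz = 2xy + q, with p, q in the span of the central elements x², y². These rules move z to the
left, so 1, x, y, xy span T over k[x², y², z]. Independence comes from the explicit 4 × 4 matrices
of right multiplication: `rep` checks that they satisfy the relations of T, and `coord_ofCoord`,
`ofCoord_coord` give mutually inverse coordinate maps.

Since modules are left modules and matrices act from the right, syzygies are linear equations in
coordinates over k[X, Y, Z]. They are solved using only that distinct variables form regular
sequences. The syzygies of (x, y, w) have the same shape for every h. The parameter h matters for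
the pair (y, w). If h is invertible, its syzygies form one free rank-one module
(`exists_of_mul_y_add_mul_w_eq_zero`) and the resolution stops. If h = 0, then w² = 0 and the
syzygies need two generators, one of them of higher degree (`exists_of_mul_y_add_mul_w_eq_zero'`).
The annihilator of w is then T w, which makes the resolution infinite.

For h ≠ 0 the resolution is linear, so T is Koszul. For h = 0 the resolution F is minimal and has a
generator of degree 4 in homological degree 3. If P were a linear projective resolution, the
identity of F would be homotopic to a composite F → P → F. Modulo the augmentation ideal the
homotopy terms vanish, while the composite kills the degree 4 generator because P₃ is generated in
degree 3. This gives 1 = 0 (`not_isKoszul_of_isGradedResolution`).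

For the twisted tensor product, T has an anti-automorphism fixing its generators. It converts
products k[x, y] · k[z] into k[z] · k[x, y], and k[x, y] is free over k[(x - l y)², y²] on the basis
that corresponds to 1, x, y, xy. The multiplication map is thereby identified with the coordinate
isomorphism. -/

noncomputable section

namespace KoszulTTP

/-! ### Direct sum decompositions described by projections -/

section Decomposition

variable {ι M σ : Type*} [DecidableEq ι] [AddCommGroup M] [SetLike σ M] [AddSubmonoidClass σ M]

/-- A family of additive subgroups is a direct sum decomposition as soon as there are compatible
projections and the subgroups generate. -/
theorem isInternal_of_proj {ℳ : ι → σ} (pr : ι → M →+ M)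
    (hpr : ∀ i n m, m ∈ ℳ i → pr n m = if i = n then m else 0)
    (hgen : ∀ m, m ∈ AddSubmonoid.closure (⋃ i, (ℳ i : Set M))) : DirectSum.IsInternal ℳ := by
  constructor
  · have key : ∀ n (f : DirectSum ι fun i => ℳ i),
        pr n (DirectSum.coeAddMonoidHom ℳ f) = f n := by
      intro n f
      induction f using DirectSum.induction_on with
      | zero => simp
      | of i m =>
        rw [DirectSum.coeAddMonoidHom_of, hpr i n m m.2, DirectSum.coe_of_apply]
        split_ifs <;> rfl
      | add f g hf hg => simp [hf, hg]
    intro f g hfg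
    ext n
    rw [← key, ← key, hfg]
  · intro m
    have : AddSubmonoid.closure (⋃ i, (ℳ i : Set M)) ≤
        AddMonoidHom.mrange (DirectSum.coeAddMonoidHom ℳ) := by
      rw [AddSubmonoid.closure_le]
      intro m hm
      obtain ⟨i, hi⟩ := Set.mem_iUnion.1 hm
      exact ⟨DirectSum.of (fun i => ℳ i) i ⟨m, hi⟩, DirectSum.coeAddMonoidHom_of _ _ _⟩
    exact this (hgen m)

theorem exists_proj {ℳ : ι → σ} (h : DirectSum.IsInternal ℳ) :
    ∃ pr : ι → M →+ M, (∀ n m, pr n m ∈ ℳ n) ∧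
      (∀ i n m, m ∈ ℳ i → pr n m = if i = n then m else 0) ∧
      ∀ m, m ∈ AddSubmonoid.closure (⋃ i, (ℳ i : Set M)) := by
  let e := AddEquiv.ofBijective (DirectSum.coeAddMonoidHom ℳ) h
  let f : ι → M →+ M := fun n =>
    { toFun := fun m => (e.symm m n : M)
      map_zero' := by simp
      map_add' := by simp }
  refine ⟨f, fun n m => (e.symm m n).2, fun i n m hm => ?_, fun m => ?_⟩
  · have : e.symm m = DirectSum.of (fun i => ℳ i) i ⟨m, hm⟩ := by
      rw [AddEquiv.symm_apply_eq]
      exact (DirectSum.coeAddMonoidHom_of ℳ i ⟨m, hm⟩).symm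
    change (e.symm m n : M) = _
    rw [this, DirectSum.coe_of_apply]
    split_ifs <;> rfl
  · obtain ⟨g, rfl⟩ := h.2 m
    induction g using DirectSum.induction_on with
    | zero => simp
    | of i m =>
      rw [DirectSum.coeAddMonoidHom_of]
      exact AddSubmonoid.subset_closure (Set.mem_iUnion.2 ⟨i, m.2⟩)
    | add f g hf hg => rw [map_add]; exact add_mem hf hg

end Decomposition

/-! ### Graded free modules and the trivial module -/

section Graded

variable {k : Type u} [Field k] {A : Type v} [Ring A] [Algebra k A] {𝒜 : ℕ → Submodule k A}

theorem intGrading_zero : intGrading 𝒜 0 = 𝒜 0 := rfl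

theorem IsConnectedGraded.one_mem (h𝒜 : IsConnectedGraded 𝒜) : (1 : A) ∈ 𝒜 0 :=
  h𝒜.gradedMonoid.one_mem

theorem IsConnectedGraded.mul_mem_intGrading (h𝒜 : IsConnectedGraded 𝒜) {i j : ℤ} {a b : A}
    (ha : a ∈ intGrading 𝒜 i) (hb : b ∈ intGrading 𝒜 j) : a * b ∈ intGrading 𝒜 (i + j) := by
  rcases i with i | i
  · rcases j with j | j
    · exact h𝒜.gradedMonoid.mul_mem ha hb
    · rw [(Submodule.mem_bot k).1 hb, mul_zero]
      exact zero_mem _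
  · rw [(Submodule.mem_bot k).1 ha, zero_mul]
    exact zero_mem _

theorem IsConnectedGraded.isInternal_intGrading (h𝒜 : IsConnectedGraded 𝒜) :
    DirectSum.IsInternal (intGrading 𝒜) := by
  obtain ⟨pr, -, h2, h3⟩ := exists_proj h𝒜.isInternal
  let pr' : ℤ → A →+ A
    | .ofNat n => pr n
    | .negSucc _ => 0
  refine isInternal_of_proj pr' (fun i n m hm => ?_) fun m => ?_
  · rcases i with i | i
    · rcases n with n | n
      · change pr n m = _
        rw [h2 i n m hm]
        simp
      · simp [pr']
    · rw [(Submodule.mem_bot k).1 hm]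
      simp
  · refine AddSubmonoid.closure_mono ?_ (h3 m)
    exact Set.iUnion_subset fun i => Set.subset_iUnion (fun i => (intGrading 𝒜 i : Set A)) (i : ℤ)

theorem mem_freeGrading {ι : Type*} {deg : ι → ℤ} {n : ℤ} {v : ι → A} :
    v ∈ freeGrading 𝒜 deg n ↔ ∀ j, v j ∈ intGrading 𝒜 (n - deg j) := by
  simp [freeGrading, Submodule.mem_pi]

theorem single_mem_freeGrading {ι : Type*} [DecidableEq ι] {deg : ι → ℤ} {n : ℤ} {j : ι} {a : A}
    (ha : a ∈ intGrading 𝒜 (n - deg j)) : Pi.single j a ∈ freeGrading 𝒜 deg n := by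
  rw [mem_freeGrading]
  intro i
  by_cases hij : i = j
  · subst hij
    simpa using ha
  · simp [hij]

theorem IsConnectedGraded.isGradedModule_freeGrading (h𝒜 : IsConnectedGraded 𝒜) {ι : Type*}
    [Finite ι] (deg : ι → ℤ) : IsGradedModule 𝒜 (freeGrading 𝒜 deg) where
  isInternal := by
    classical
    have := Fintype.ofFinite ι
    obtain ⟨pr, h1, h2, h3⟩ := exists_proj h𝒜.isInternal_intGrading
    let pr' : ℤ → (ι → A) →+ (ι → A) := fun n =>
      { toFun := fun v j => pr (n - deg j) (v j)
        map_zero' := by ext; simp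
        map_add' := fun v w => by ext; simp }
    refine isInternal_of_proj pr' (fun i n v hv => ?_) fun v => ?_
    · ext j
      change pr (n - deg j) (v j) = _
      rw [h2 _ _ _ (mem_freeGrading.1 hv j)]
      by_cases h : i = n <;> simp [h]
    · rw [← Finset.univ_sum_single v]
      refine sum_mem fun j _ => ?_
      have key := h3 (v j)
      generalize v j = a at key
      induction key using AddSubmonoid.closure_induction with
      | mem a ha =>
        obtain ⟨i, hi⟩ := Set.mem_iUnion.1 ha
        refine AddSubmonoid.subset_closure (Set.mem_iUnion.2 ⟨i + deg j, ?_⟩)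
        exact single_mem_freeGrading (by simpa using hi)
      | zero => simp
      | add a b _ _ ha hb => rw [Pi.single_add]; exact add_mem ha hb
  smul_mem i j a v ha hv := by
    rw [mem_freeGrading] at hv ⊢
    intro l
    have := h𝒜.mul_mem_intGrading (i := (i : ℤ)) ha (hv l)
    rwa [← add_sub_assoc] at this

theorem IsConnectedGraded.isGradedFree_freeGrading (h𝒜 : IsConnectedGraded 𝒜) {n : ℕ}
    (deg : Fin n → ℤ) : IsGradedFree 𝒜 (freeGrading 𝒜 deg) := by
  -- `ULift` only moves the index type into the required universe.
  refine ⟨h𝒜.isGradedModule_freeGrading deg, ULift.{v} (Fin n),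
    (Pi.basisFun A (Fin n)).reindex Equiv.ulift.symm, fun i => ⟨deg i.down, ?_⟩⟩
  simp only [Module.Basis.reindex_apply, Equiv.symm_symm, Pi.basisFun_apply]
  refine single_mem_freeGrading ?_
  simpa [intGrading_zero] using h𝒜.one_mem

theorem IsConnectedGraded.vecMul_mem_freeGrading (h𝒜 : IsConnectedGraded 𝒜) {m n : ℕ}
    {deg : Fin m → ℤ} {deg' : Fin n → ℤ} {D : Matrix (Fin m) (Fin n) A}
    (hD : ∀ i j, D i j ∈ intGrading 𝒜 (deg i - deg' j)) {l : ℤ} {v : Fin m → A}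
    (hv : v ∈ freeGrading 𝒜 deg l) : D.vecMulLinear v ∈ freeGrading 𝒜 deg' l := by
  rw [mem_freeGrading] at hv ⊢
  intro j
  rw [Matrix.vecMulLinear_apply, Matrix.vecMul, dotProduct]
  refine Submodule.sum_mem _ fun i _ => ?_
  have := h𝒜.mul_mem_intGrading (hv i) (hD i j)
  rwa [sub_add_sub_cancel] at this

/-- The projection `A → A / A₊` on the free module of rank one. -/
def freeAugmentation (𝒜 : ℕ → Submodule k A) : (Fin 1 → A) →ₗ[A] TrivialModule 𝒜 :=
  (augIdeal 𝒜).mkQ ∘ₗ LinearMap.proj 0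

theorem freeAugmentation_surjective : Function.Surjective (freeAugmentation 𝒜) := by
  intro q
  obtain ⟨a, rfl⟩ := (augIdeal 𝒜).mkQ_surjective q
  exact ⟨fun _ => a, rfl⟩

theorem freeAugmentation_mem {n : ℤ} {v : Fin 1 → A}
    (hv : v ∈ freeGrading 𝒜 (fun _ : Fin 1 => (0 : ℤ)) n) :
    freeAugmentation 𝒜 v ∈ trivialGrading 𝒜 n := by
  have := mem_freeGrading.1 hv 0
  rw [sub_zero] at this
  exact ⟨v 0, this, rfl⟩

/-- A product of positive length ends in a degree-one factor, so it already lies in the left ideal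
generated by `s`. -/
theorem augIdeal_eq_span {s : Set A} (hs : ∀ n, 𝒜 n = Submodule.span k s ^ n) :
    augIdeal 𝒜 = Submodule.span A s := by
  refine le_antisymm (Submodule.span_le.2 ?_) (Submodule.span_le.2 ?_)
  · rintro a ⟨n, hn, ha⟩
    obtain ⟨n, rfl⟩ := Nat.exists_eq_succ_of_ne_zero hn.ne'
    rw [hs, pow_succ] at ha
    refine Submodule.mul_induction_on ha (fun b _ c hc => ?_) fun b c hb hc => add_mem hb hc
    refine Submodule.smul_mem (Submodule.span A s) b ?_
    exact Submodule.span_le_restrictScalars k A s hc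
  · intro a ha
    refine Submodule.subset_span ⟨1, one_pos, ?_⟩
    rw [hs, pow_one]
    exact Submodule.subset_span ha

/-- The matrix with one column whose entries generate `A₊` is a presentation of `A / A₊`. -/
theorem exact_freeAugmentation {m : ℕ} {D : Matrix (Fin m) (Fin 1) A}
    (hs : ∀ n, 𝒜 n = Submodule.span k (Set.range fun i => D i 0) ^ n) :
    Function.Exact D.vecMulLinear (freeAugmentation 𝒜) := by
  intro v
  have h1 : freeAugmentation 𝒜 v = 0 ↔ v 0 ∈ augIdeal 𝒜 :=
    Submodule.Quotient.mk_eq_zero (augIdeal 𝒜)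
  rw [h1, augIdeal_eq_span hs, Submodule.mem_span_range_iff_exists_fun]
  constructor
  · rintro ⟨c, hc⟩
    refine ⟨c, ?_⟩
    ext j
    rw [Subsingleton.elim j 0, ← hc]
    rfl
  · rintro ⟨c, rfl⟩
    exact ⟨c, rfl⟩

/-- A linear free resolution shows that an algebra is Koszul. -/
theorem IsConnectedGraded.isKoszul_of_isGradedResolution (h𝒜 : IsConnectedGraded 𝒜)
    {rank : ℕ → ℕ} {d : ∀ i, (Fin (rank (i + 1)) → A) →ₗ[A] (Fin (rank i) → A)}
    {ε : (Fin (rank 0) → A) →ₗ[A] TrivialModule 𝒜}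
    (hres : IsGradedResolution 𝒜 (P := fun i => Fin (rank i) → A)
      (fun i => freeGrading 𝒜 fun _ => (i : ℤ)) d ε) : IsKoszul 𝒜 := by
  refine ⟨fun i => Fin (rank i) → A, fun _ => inferInstance, fun _ => inferInstance, _, d, ε, hres,
    fun i => inferInstance, fun i => ?_⟩
  rw [IsGeneratedInDegree, eq_top_iff, ← (Pi.basisFun A (Fin (rank i))).span_eq]
  refine Submodule.span_mono ?_
  rintro _ ⟨j, rfl⟩
  rw [Pi.basisFun_apply]
  refine single_mem_freeGrading ?_
  simpa [intGrading_zero] using h𝒜.one_mem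

end Graded

/-! ### Invariance of the Koszul property under graded isomorphism -/

section Transport

variable {k : Type u} [Field k] {A B : Type v} [Ring A] [Algebra k A] [Ring B] [Algebra k B]
  {𝒜 : ℕ → Submodule k A} {ℬ : ℕ → Submodule k B}

theorem intGrading_map (φ : A ≃ₐ[k] B) (hφ : ∀ n, (𝒜 n).map φ.toLinearMap = ℬ n) {n : ℤ} {a : A} :
    φ a ∈ intGrading ℬ n ↔ a ∈ intGrading 𝒜 n := by
  rcases n with n | n
  · change φ a ∈ ℬ n ↔ a ∈ 𝒜 n
    rw [← hφ]
    constructor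
    · rintro ⟨b, hb, hab⟩
      rwa [← φ.injective hab]
    · exact fun h => ⟨a, h, rfl⟩
  · change φ a ∈ (⊥ : Submodule k B) ↔ a ∈ (⊥ : Submodule k A)
    simp

theorem mem_augIdeal_map (φ : A ≃ₐ[k] B) (hφ : ∀ n, (𝒜 n).map φ.toLinearMap = ℬ n) {a : A}
    (ha : a ∈ augIdeal 𝒜) : φ a ∈ augIdeal ℬ := by
  induction ha using Submodule.span_induction with
  | mem a h =>
    obtain ⟨n, hn, ha⟩ := h
    exact Submodule.subset_span ⟨n, hn, (intGrading_map φ hφ (n := (n : ℤ))).2 ha⟩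
  | zero => simp
  | add a b _ _ ha hb => rw [map_add]; exact add_mem ha hb
  | smul a b _ hb => rw [smul_eq_mul, map_mul]; exact Submodule.smul_mem _ _ hb

theorem map_grading_symm (φ : A ≃ₐ[k] B) (hφ : ∀ n, (𝒜 n).map φ.toLinearMap = ℬ n) (n : ℕ) :
    (ℬ n).map φ.symm.toLinearMap = 𝒜 n := by
  ext a
  rw [← hφ]
  simp

/-- The isomorphism of trivial modules induced by an isomorphism of graded algebras. -/
def trivialModuleEquiv (φ : A ≃ₐ[k] B) (hφ : ∀ n, (𝒜 n).map φ.toLinearMap = ℬ n) :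
    TrivialModule 𝒜 ≃+ TrivialModule ℬ :=
  QuotientAddGroup.congr _ _ φ.toRingEquiv.toAddEquiv <| by
    ext b
    simp only [AddSubgroup.mem_map, Submodule.mem_toAddSubgroup]
    constructor
    · rintro ⟨a, ha, rfl⟩
      exact mem_augIdeal_map φ hφ ha
    · intro hb
      exact ⟨φ.symm b, mem_augIdeal_map φ.symm (map_grading_symm φ hφ) hb, φ.apply_symm_apply b⟩

theorem trivialModuleEquiv_smul (φ : A ≃ₐ[k] B) (hφ : ∀ n, (𝒜 n).map φ.toLinearMap = ℬ n) (a : A)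
    (q : TrivialModule 𝒜) : trivialModuleEquiv φ hφ (a • q) = φ a • trivialModuleEquiv φ hφ q := by
  obtain ⟨b, rfl⟩ := (augIdeal 𝒜).mkQ_surjective q
  change (augIdeal ℬ).mkQ (φ (a * b)) = (augIdeal ℬ).mkQ (φ a * φ b)
  rw [map_mul]

/-- The groups, gradings and underlying differentials are kept, and B acts through the inverse of
`φ`. Only the augmentation changes, by the induced isomorphism of trivial modules. -/
theorem IsKoszul.of_algEquiv (φ : A ≃ₐ[k] B) (hφ : ∀ n, (𝒜 n).map φ.toLinearMap = ℬ n)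
    (h : IsKoszul 𝒜) : IsKoszul ℬ := by
  obtain ⟨P, instP, modP, 𝒢, d, ε, hres, hproj, hgen⟩ := h
  let modB : ∀ i, Module B (P i) := fun i =>
    Module.compHom (P i) (φ.symm : B ≃+* A).toRingHom
  have smul_def : ∀ i (b : B) (p : P i), b • p = φ.symm b • p := fun _ _ _ => rfl
  let d' : ∀ i, P (i + 1) →ₗ[B] P i := fun i =>
    { toFun := d i
      map_add' := map_add (d i)
      map_smul' := fun b p => by simp [smul_def] }
  let ε' : P 0 →ₗ[B] TrivialModule ℬ :=
    { toFun := fun p => trivialModuleEquiv φ hφ (ε p)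
      map_add' := fun p q => by rw [map_add, map_add]
      map_smul' := fun b p => by
        rw [smul_def, map_smul, trivialModuleEquiv_smul, φ.apply_symm_apply, RingHom.id_apply] }
  refine ⟨P, instP, modB, 𝒢, d', ε', ⟨fun i => ⟨(hres.graded i).isInternal, ?_⟩, hres.d_mem, ?_,
    hres.exact_succ, ?_, ?_⟩, fun i => ?_, fun i => ?_⟩
  · intro n j b p hb hp
    rw [smul_def]
    refine (hres.graded i).smul_mem n j _ _ ?_ hp
    exact (intGrading_map φ.symm (map_grading_symm φ hφ) (n := (n : ℤ))).2 hb
  · intro n p hp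
    obtain ⟨a, ha, hap⟩ := hres.ε_mem n p hp
    refine ⟨φ a, (intGrading_map φ hφ).2 ha, ?_⟩
    change _ = trivialModuleEquiv φ hφ (ε p)
    rw [← hap]
    rfl
  · intro p
    change trivialModuleEquiv φ hφ (ε p) = 0 ↔ _
    rw [EmbeddingLike.map_eq_zero_iff]
    exact hres.exact_zero p
  · exact (trivialModuleEquiv φ hφ).surjective.comp hres.surjective
  · have := hproj i
    have := RingHomInvPair.of_ringEquiv (φ : A ≃+* B)
    have := RingHomInvPair.of_ringEquiv (φ : A ≃+* B).symm
    exact Module.Projective.of_equiv (σ := ((φ : A ≃+* B) : A →+* B))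
      (σ' := ((φ : A ≃+* B).symm : B →+* A))
      { AddEquiv.refl (P i) with
        map_smul' := fun a p => by
          change a • p = φ.symm (φ a) • p
          rw [φ.symm_apply_apply] }
  · rw [IsGeneratedInDegree, eq_top_iff]
    intro p _
    have hp : p ∈ Submodule.span A (𝒢 i i : Set (P i)) := by
      rw [show Submodule.span A (𝒢 i i : Set (P i)) = ⊤ from hgen i]
      trivial
    induction hp using Submodule.span_induction with
    | mem p h => exact Submodule.subset_span h
    | zero => exact zero_mem _
    | add p q _ _ hp hq => exact add_mem (hp trivial) (hq trivial)
    | smul a p _ hp =>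
      have := Submodule.smul_mem _ (φ a) (hp trivial)
      rwa [smul_def, φ.symm_apply_apply] at this

theorem isKoszul_congr (φ : A ≃ₐ[k] B) (hφ : ∀ n, (𝒜 n).map φ.toLinearMap = ℬ n) :
    IsKoszul 𝒜 ↔ IsKoszul ℬ :=
  ⟨.of_algEquiv φ hφ, .of_algEquiv φ.symm (map_grading_symm φ hφ)⟩

end Transport

/-! ### Algebras with quadratic presentations: grading and quadraticity -/

section PresentedAlgebras

variable {k : Type u} [Field k] {rels : Set (FreeAlgebra k (Fin 3))}

theorem Presented.mk_surjective : Function.Surjective (Presented.mk rels) :=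
  RingQuot.mkAlgHom_surjective k _

theorem Presented.mk_eq_zero {r : FreeAlgebra k (Fin 3)} (hr : r ∈ rels) :
    Presented.mk rels r = 0 := by
  have := RingQuot.mkAlgHom_rel k
    (s := fun p q : FreeAlgebra k (Fin 3) => p ∈ rels ∧ q = 0) ⟨hr, rfl⟩
  exact this.trans (map_zero (Presented.mk rels))

theorem Presented.mk_ι (i : Fin 3) : Presented.mk rels (FreeAlgebra.ι k i) = gen rels i := rfl

/-- The homomorphism from a presented algebra given by the images of the generators. -/
def Presented.lift {B : Type*} [Ring B] [Algebra k B] (f : Fin 3 → B)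
    (hf : ∀ r ∈ rels, FreeAlgebra.lift k f r = 0) : Presented rels →ₐ[k] B :=
  RingQuot.liftAlgHom k
    ⟨FreeAlgebra.lift k f, fun p q h => by rw [h.2, map_zero]; exact hf p h.1⟩

theorem Presented.lift_mk {B : Type*} [Ring B] [Algebra k B] (f : Fin 3 → B)
    (hf : ∀ r ∈ rels, FreeAlgebra.lift k f r = 0) (p : FreeAlgebra k (Fin 3)) :
    Presented.lift f hf (Presented.mk rels p) = FreeAlgebra.lift k f p :=
  RingQuot.liftAlgHom_mkAlgHom_apply k _ _ _

@[simp]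
theorem Presented.lift_gen {B : Type*} [Ring B] [Algebra k B] (f : Fin 3 → B)
    (hf : ∀ r ∈ rels, FreeAlgebra.lift k f r = 0) (i : Fin 3) :
    Presented.lift f hf (gen rels i) = f i := by
  rw [← Presented.mk_ι, Presented.lift_mk, FreeAlgebra.lift_ι_apply]

theorem Presented.lift_comp_mk {B : Type*} [Ring B] [Algebra k B]
    (φ : Presented rels →ₐ[k] B) (p : FreeAlgebra k (Fin 3)) :
    FreeAlgebra.lift k (fun i => φ (gen rels i)) p = φ (Presented.mk rels p) := by
  have : FreeAlgebra.lift k (fun i => φ (gen rels i)) = φ.comp (Presented.mk rels) := by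
    ext i
    simp [Presented.mk_ι]
  rw [this, AlgHom.comp_apply]

theorem Presented.algHom_ext {B : Type*} [Ring B] [Algebra k B] {φ ψ : Presented rels →ₐ[k] B}
    (h : ∀ i, φ (gen rels i) = ψ (gen rels i)) : φ = ψ := by
  ext a
  obtain ⟨p, rfl⟩ := Presented.mk_surjective a
  rw [← Presented.lift_comp_mk, ← Presented.lift_comp_mk, funext h]

theorem adjoin_range_gen (rels : Set (FreeAlgebra k (Fin 3))) :
    Algebra.adjoin k (Set.range (gen rels)) = ⊤ := by
  have h : Set.range (gen rels) = Presented.mk rels '' Set.range (FreeAlgebra.ι k) := by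
    rw [← Set.range_comp]
    rfl
  rw [h, ← AlgHom.map_adjoin, FreeAlgebra.adjoin_range_ι, Algebra.map_top,
    AlgHom.range_eq_top]
  exact Presented.mk_surjective

@[elab_as_elim]
theorem Presented.induction {motive : Presented rels → Prop} (a : Presented rels)
    (algebraMap : ∀ c : k, motive (algebraMap k _ c)) (gen : ∀ i, motive (gen rels i))
    (add : ∀ a b, motive a → motive b → motive (a + b))
    (mul : ∀ a b, motive a → motive b → motive (a * b)) : motive a := by
  have ha : a ∈ Algebra.adjoin k (Set.range (KoszulTTP.gen rels)) := by
    rw [adjoin_range_gen]; trivial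
  induction ha using Algebra.adjoin_induction with
  | mem a h => obtain ⟨i, rfl⟩ := h; exact gen i
  | algebraMap c => exact algebraMap c
  | add a b _ _ ha hb => exact add a b ha hb
  | mul a b _ _ ha hb => exact mul a b ha hb

/-- A family of relations is quadratic if it consists of combinations of words of length two. -/
def QuadraticRels (rels : Set (FreeAlgebra k (Fin 3))) : Prop :=
  ∀ r ∈ rels, r ∈ Submodule.span k (Set.range (FreeAlgebra.ι k (X := Fin 3))) ^ 2

theorem gen_mem_wordGrading (i : Fin 3) : gen rels i ∈ wordGrading rels 1 := by
  rw [wordGrading, pow_one]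
  exact Submodule.subset_span ⟨i, rfl⟩

/-- Marking each generator with a variable t records word length. This makes the marking well
defined modulo homogeneous relations, and yields the grading projections. -/
theorem lift_monomial {n : ℕ} {p : FreeAlgebra k (Fin 3)}
    (hp : p ∈ Submodule.span k (Set.range (FreeAlgebra.ι k (X := Fin 3))) ^ n) :
    FreeAlgebra.lift k (fun i => Polynomial.monomial 1 (gen rels i)) p =
      Polynomial.monomial n (Presented.mk rels p) := by
  induction hp using Submodule.pow_induction_on_left' with
  | algebraMap c =>
    rw [AlgHom.commutes, AlgHom.commutes]
    rfl
  | add p q n _ _ hp hq => rw [map_add, map_add, map_add, hp, hq]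
  | mem_mul m hm n p _ hp =>
    have h : FreeAlgebra.lift k (fun i => Polynomial.monomial 1 (gen rels i)) m =
        Polynomial.monomial 1 (Presented.mk rels m) := by
      induction hm using Submodule.span_induction with
      | mem m h =>
        obtain ⟨i, rfl⟩ := h
        rw [FreeAlgebra.lift_ι_apply, Presented.mk_ι]
      | zero => simp
      | add p q _ _ hp hq => rw [map_add, map_add, map_add, hp, hq]
      | smul c p _ hp => rw [map_smul, map_smul, hp, Polynomial.smul_monomial]
    rw [map_mul, map_mul, hp, h, Polynomial.monomial_mul_monomial, Nat.add_comm, Nat.succ_eq_add_one]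

/-- The homomorphism `a ↦ a tⁿ` for `a` of degree `n`. -/
def gradingHom (hrels : QuadraticRels rels) :
    Presented rels →ₐ[k] Polynomial (Presented rels) :=
  Presented.lift (fun i => Polynomial.monomial 1 (gen rels i)) fun r hr => by
    rw [lift_monomial (hrels r hr), Presented.mk_eq_zero hr, map_zero]

theorem gradingHom_apply (hrels : QuadraticRels rels) {n : ℕ} {a : Presented rels}
    (ha : a ∈ wordGrading rels n) : gradingHom hrels a = Polynomial.monomial n a := by
  have h : wordGrading rels n = (Submodule.span k (Set.range (FreeAlgebra.ι k (X := Fin 3))) ^ n).map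
      (Presented.mk rels).toLinearMap := by
    rw [Submodule.map_pow, Submodule.map_span, ← Set.range_comp]
    rfl
  rw [h] at ha
  obtain ⟨p, hp, rfl⟩ := ha
  exact (Presented.lift_mk _ _ _).trans (lift_monomial hp)

/-- The augmentation of a quadratic algebra, which kills the generators. -/
def aug (hrels : QuadraticRels rels) : Presented rels →ₐ[k] k :=
  Presented.lift (fun _ => 0) fun r hr => by
    have h := hrels r hr
    rw [pow_two] at h
    have h0 : ∀ p ∈ Submodule.span k (Set.range (FreeAlgebra.ι k (X := Fin 3))),
        FreeAlgebra.lift k (fun _ : Fin 3 => (0 : k)) p = 0 := by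
      intro p hp
      induction hp using Submodule.span_induction with
      | mem m h => obtain ⟨i, rfl⟩ := h; rw [FreeAlgebra.lift_ι_apply]
      | zero => simp
      | add p q _ _ hp hq => rw [map_add, hp, hq, add_zero]
      | smul c p _ hp => rw [map_smul, hp, smul_zero]
    refine Submodule.mul_induction_on h (fun p hp q _ => ?_) fun p q hp hq => ?_
    · rw [map_mul, h0 p hp, zero_mul]
    · rw [map_add, hp, hq, add_zero]

@[simp]
theorem aug_gen (hrels : QuadraticRels rels) (i : Fin 3) : aug hrels (gen rels i) = 0 :=
  Presented.lift_gen _ _ _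

theorem isConnectedGraded_wordGrading (hrels : QuadraticRels rels) :
    IsConnectedGraded (wordGrading rels) where
  nontrivial := (aug hrels).toRingHom.domain_nontrivial
  gradedMonoid := Submodule.nat_power_gradedMonoid _
  isInternal := by
    -- The projection to degree n is the coefficient of tⁿ in the marked element.
    let pr : ℕ → Presented rels →+ Presented rels := fun n =>
      (Polynomial.lcoeff (Presented rels) n).toAddMonoidHom.comp
        (gradingHom hrels : Presented rels →+ Polynomial (Presented rels))
    refine isInternal_of_proj pr (fun i n a ha => ?_) fun a => ?_
    · change (gradingHom hrels a).coeff n = _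
      rw [gradingHom_apply hrels ha, Polynomial.coeff_monomial]
    · have hmem : ∀ n, ∀ a ∈ wordGrading rels n,
          a ∈ AddSubmonoid.closure (⋃ i, (wordGrading rels i : Set (Presented rels))) :=
        fun n a ha => AddSubmonoid.subset_closure (Set.mem_iUnion.2 ⟨n, ha⟩)
      induction a using Presented.induction with
      | algebraMap c => exact hmem 0 _ (Submodule.algebraMap_mem c)
      | gen i => exact hmem 1 _ (gen_mem_wordGrading i)
      | add a b ha hb => exact add_mem ha hb
      | mul a b ha hb =>
        induction ha using AddSubmonoid.closure_induction with
        | zero => simp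
        | add a a' _ _ ha ha' => rw [add_mul]; exact add_mem ha ha'
        | mem a ha =>
          obtain ⟨m, hm⟩ := Set.mem_iUnion.1 ha
          induction hb using AddSubmonoid.closure_induction with
          | zero => simp
          | add b b' _ _ hb hb' => rw [mul_add]; exact add_mem hb hb'
          | mem b hb =>
            obtain ⟨n, hn⟩ := Set.mem_iUnion.1 hb
            refine hmem (m + n) _ ?_
            rw [wordGrading, pow_add]
            exact Submodule.mul_mem_mul hm hn
  connected := pow_zero _
  finitelyGenerated := by
    classical
    refine ⟨Finset.univ.image (gen rels), fun a ha => ?_, ?_⟩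
    · obtain ⟨i, -, rfl⟩ := Finset.mem_image.1 ha
      exact ⟨1, gen_mem_wordGrading i⟩
    · rw [Finset.coe_image, Finset.coe_univ, Set.image_univ, adjoin_range_gen]

/-- A presented algebra is quadratic if its relations are. -/
theorem isQuadratic_wordGrading (hrels : QuadraticRels rels) : IsQuadratic (wordGrading rels) := by
  set V := wordGrading rels 1 with hV
  let v : Fin 3 → V := fun i => ⟨gen rels i, gen_mem_wordGrading i⟩
  set π := TensorAlgebra.lift k V.subtype with hπ
  set R := TwoSidedIdeal.span {t | t ∈ LinearMap.range (TensorAlgebra.ι k (M := V)) ^ 2 ∧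
      π t = 0} with hR
  let f : FreeAlgebra k (Fin 3) →ₐ[k] TensorAlgebra k V :=
    FreeAlgebra.lift k fun i => TensorAlgebra.ι k (v i)
  have hπf : ∀ p, π (f p) = Presented.mk rels p := by
    intro p
    have : π.comp f = Presented.mk rels := by
      ext i
      simp [f, hπ, v, Presented.mk_ι]
    rw [← this, AlgHom.comp_apply]
  refine ⟨fun a => ?_, le_antisymm ?_ ?_⟩
  · obtain ⟨p, rfl⟩ := Presented.mk_surjective a
    exact ⟨f p, hπf p⟩
  · have hf2 : ∀ r ∈ rels, f r ∈ R := by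
      intro r hr
      refine TwoSidedIdeal.subset_span ⟨?_, ?_⟩
      · have h := Submodule.mem_map_of_mem (f := f.toLinearMap) (hrels r hr)
        rw [Submodule.map_pow, Submodule.map_span, ← Set.range_comp] at h
        refine pow_le_pow_left' (Submodule.span_le.2 ?_) 2 h
        rintro _ ⟨i, rfl⟩
        exact ⟨v i, by simp [f]⟩
      · rw [hπf, Presented.mk_eq_zero hr]
    let q : TensorAlgebra k V →ₐ[k] R.ringCon.Quotient := R.ringCon.mkₐ k
    have hq : ∀ t, q t = 0 ↔ t ∈ R := fun t => RingCon.eq R.ringCon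
    -- The relations die modulo `R`, so the quotient map by `R` factors through `π`. This forces the
    -- kernel of `π` into `R`.
    let s : Presented rels →ₐ[k] R.ringCon.Quotient :=
      Presented.lift (fun i => q (TensorAlgebra.ι k (v i))) fun r hr => by
        have : FreeAlgebra.lift k (fun i => q (TensorAlgebra.ι k (v i))) = q.comp f := by
          ext i
          simp [f]
        rw [this, AlgHom.comp_apply, hq]
        exact hf2 r hr
    have hV1 : V = Submodule.span k (Set.range (gen rels)) := pow_one _
    have hs : s.comp π = q := by
      refine TensorAlgebra.hom_ext (LinearMap.ext fun ⟨a, ha⟩ => ?_)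
      have h := ha
      rw [hV1] at h
      -- The membership proof is generalized so that span induction on `a` is possible although `a`
      -- occurs inside a subtype.
      suffices hsa : ∀ ha : a ∈ V, s a = q (TensorAlgebra.ι k ⟨a, ha⟩) by
        simpa [hπ] using hsa ha
      clear ha
      induction h using Submodule.span_induction with
      | mem a h =>
        obtain ⟨i, rfl⟩ := h
        intro _
        exact Presented.lift_gen _ _ _
      | zero =>
        intro h0
        rw [map_zero, show (⟨0, h0⟩ : V) = 0 from rfl, map_zero, map_zero]
      | add a b ha hb iha ihb =>
        intro hab
        rw [← hV1] at ha hb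
        rw [map_add, iha ha, ihb hb, ← map_add, ← map_add]
        rfl
      | smul c a ha iha =>
        intro hca
        rw [← hV1] at ha
        rw [map_smul, iha ha, ← map_smul, ← map_smul]
        rfl
    intro t ht
    rw [← hq, ← hs, AlgHom.comp_apply, (TwoSidedIdeal.mem_ker _).1 ht, map_zero]
  · rw [TwoSidedIdeal.span_le]
    rintro t ⟨-, ht⟩
    exact (TwoSidedIdeal.mem_ker _).2 ht

end PresentedAlgebras

/-! ### The defining relations of T and its central elements -/

section Relations

variable {k : Type u} [Field k]

theorem ι_mul_ι_mem (i j : Fin 3) : FreeAlgebra.ι k i * FreeAlgebra.ι k j ∈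
    Submodule.span k (Set.range (FreeAlgebra.ι k (X := Fin 3))) ^ 2 := by
  rw [pow_two]
  exact Submodule.mul_mem_mul (Submodule.subset_span ⟨i, rfl⟩) (Submodule.subset_span ⟨j, rfl⟩)

theorem quadraticRels_weierstrassRels (g h : k) : QuadraticRels (weierstrassRels g h) := by
  have hm := ι_mul_ι_mem (k := k)
  rintro r (rfl | rfl | rfl)
  · rw [pow_two (FreeAlgebra.ι k (0 : Fin 3)), pow_two (FreeAlgebra.ι k (1 : Fin 3))]
    exact sub_mem (sub_mem (add_mem (hm _ _) (hm _ _)) (hm _ _)) (Submodule.smul_mem _ _ (hm _ _))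
  · rw [pow_two (FreeAlgebra.ι k (2 : Fin 3)), pow_two (FreeAlgebra.ι k (1 : Fin 3))]
    exact add_mem (hm _ _) (Submodule.smul_mem _ _ (hm _ _))
  · exact sub_mem (hm _ _) (hm _ _)

theorem quadraticRels_twistedRels (a b c d e f A B C D E F : k) :
    QuadraticRels (twistedRels a b c d e f A B C D E F) := by
  have hm := ι_mul_ι_mem (k := k)
  have hs : ∀ (r : k) (i j : Fin 3), r • (FreeAlgebra.ι k i * FreeAlgebra.ι k j) ∈
      Submodule.span k (Set.range (FreeAlgebra.ι k (X := Fin 3))) ^ 2 :=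
    fun r i j => Submodule.smul_mem _ _ (hm i j)
  rintro r (rfl | rfl | rfl)
  · rw [pow_two (FreeAlgebra.ι k (0 : Fin 3)), pow_two (FreeAlgebra.ι k (1 : Fin 3)),
      pow_two (FreeAlgebra.ι k (2 : Fin 3))]
    exact sub_mem (hm _ _) (add_mem (add_mem (add_mem (add_mem (add_mem (hs _ _ _) (hs _ _ _))
      (hs _ _ _)) (hs _ _ _)) (hs _ _ _)) (hs _ _ _))
  · rw [pow_two (FreeAlgebra.ι k (0 : Fin 3)), pow_two (FreeAlgebra.ι k (1 : Fin 3)),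
      pow_two (FreeAlgebra.ι k (2 : Fin 3))]
    exact sub_mem (hm _ _) (add_mem (add_mem (add_mem (add_mem (add_mem (hs _ _ _) (hs _ _ _))
      (hs _ _ _)) (hs _ _ _)) (hs _ _ _)) (hs _ _ _))
  · exact sub_mem (hm _ _) (hm _ _)

variable (g h : k)

theorem y_mul_x : y g h * x g h = x g h * y g h := by
  have := Presented.mk_eq_zero (rels := weierstrassRels g h)
    (r := FreeAlgebra.ι k 0 * FreeAlgebra.ι k 1 - FreeAlgebra.ι k 1 * FreeAlgebra.ι k 0)
    (by simp [weierstrassRels])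
  simp only [map_sub, map_mul, Presented.mk_ι] at this
  exact (sub_eq_zero.1 this).symm

theorem w_mul_y : w g h * y g h =
    -(y g h * w g h) + x g h * x g h + g • (y g h * y g h) := by
  have := Presented.mk_eq_zero (rels := weierstrassRels g h)
    (r := FreeAlgebra.ι k 2 * FreeAlgebra.ι k 1 + FreeAlgebra.ι k 1 * FreeAlgebra.ι k 2 -
      FreeAlgebra.ι k 0 ^ 2 - g • FreeAlgebra.ι k 1 ^ 2) (by simp [weierstrassRels])
  simp only [map_sub, map_add, map_smul, map_mul, Presented.mk_ι, pow_two] at this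
  change w g h * y g h + y g h * w g h - x g h * x g h - g • (y g h * y g h) = 0 at this
  rw [← sub_eq_zero, ← this]
  module

theorem w_mul_w : w g h * w g h = -(h • (y g h * y g h)) := by
  have := Presented.mk_eq_zero (rels := weierstrassRels g h)
    (r := FreeAlgebra.ι k 2 ^ 2 + h • FreeAlgebra.ι k 1 ^ 2) (by simp [weierstrassRels])
  simp only [map_add, map_smul, map_mul, Presented.mk_ι, pow_two] at this
  exact eq_neg_of_add_eq_zero_left this

/-- Up to sign, w passes each y at the cost of x² + g y². Two passes cancel the sign, and the two
correction terms cancel because x² + g y² commutes with y. -/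
theorem commute_w_sq_y : Commute (w g h) (y g h * y g h) := by
  have h1 := w_mul_y g h
  have h2 := y_mul_x g h
  generalize w g h = w at *
  generalize y g h = y at *
  generalize x g h = x at *
  calc w * (y * y) = (w * y) * y := by rw [mul_assoc]
    _ = -(y * (w * y)) + x * (x * y) + g • (y * (y * y)) := by
      rw [h1]; simp only [add_mul, neg_mul, smul_mul_assoc, mul_assoc, h1]
    _ = y * y * w := by
      rw [h1]
      simp only [mul_add, mul_neg, mul_smul_comm, ← mul_assoc, h2]
      rw [mul_assoc x y x, h2, ← mul_assoc]
      abel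

theorem commute_y_sq_x : Commute (y g h) (x g h * x g h) := by
  have h2 : Commute (y g h) (x g h) := y_mul_x g h
  exact h2.mul_right h2

/-- The relation expresses x² as wy + yw - g y². The element w commutes with wy + yw because w², a
multiple of y², commutes with y. -/
theorem commute_w_sq_x : Commute (w g h) (x g h * x g h) := by
  have h1 : x g h * x g h =
      w g h * y g h + y g h * w g h - g • (y g h * y g h) := by
    rw [w_mul_y]; abel
  rw [h1]
  refine Commute.sub_right ?_ ((commute_w_sq_y g h).smul_right g)
  have h2 : w g h * w g h * y g h = y g h * (w g h * w g h) := by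
    rw [w_mul_w]
    simp only [neg_mul, mul_neg, smul_mul_assoc, mul_smul_comm, mul_assoc]
  change w g h * (_ + _) = (_ + _) * w g h
  rw [mul_add, add_mul, ← mul_assoc, h2]
  simp only [mul_assoc]
  abel

end Relations

/-! ### The change of variables between E and T -/

section EllipticIso

variable {k : Type u} [Field k] {a c B C g h l : k}

theorem gen_one_mul_gen_zero (a c B C : k) :
    gen (ellipticRels a c B C) 1 * gen (ellipticRels a c B C) 0 =
      gen (ellipticRels a c B C) 0 * gen (ellipticRels a c B C) 1 := by
  have := Presented.mk_eq_zero (rels := ellipticRels a c B C)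
    (r := FreeAlgebra.ι k 0 * FreeAlgebra.ι k 1 - FreeAlgebra.ι k 1 * FreeAlgebra.ι k 0)
    (by simp [ellipticRels, twistedRels])
  simp only [map_sub, map_mul, Presented.mk_ι] at this
  exact (sub_eq_zero.1 this).symm

theorem gen_two_mul_gen_zero (a c B C : k) :
    gen (ellipticRels a c B C) 2 * gen (ellipticRels a c B C) 0 =
      a • (gen (ellipticRels a c B C) 0 * gen (ellipticRels a c B C) 0) +
      ((1 - a) * (2 - B)) • (gen (ellipticRels a c B C) 0 * gen (ellipticRels a c B C) 1) +
      c • (gen (ellipticRels a c B C) 1 * gen (ellipticRels a c B C) 1) -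
      gen (ellipticRels a c B C) 0 * gen (ellipticRels a c B C) 2 +
      gen (ellipticRels a c B C) 2 * gen (ellipticRels a c B C) 2 := by
  have := Presented.mk_eq_zero (rels := ellipticRels a c B C) (Set.mem_insert _ _)
  simp only [map_sub, map_add, map_smul, map_mul, Presented.mk_ι, pow_two] at this
  rw [← sub_eq_zero, ← this]
  module

theorem gen_two_mul_gen_one (a c B C : k) :
    gen (ellipticRels a c B C) 2 * gen (ellipticRels a c B C) 1 =
      gen (ellipticRels a c B C) 0 * gen (ellipticRels a c B C) 0 +
      B • (gen (ellipticRels a c B C) 0 * gen (ellipticRels a c B C) 1) +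
      C • (gen (ellipticRels a c B C) 1 * gen (ellipticRels a c B C) 1) -
      gen (ellipticRels a c B C) 1 * gen (ellipticRels a c B C) 2 := by
  have := Presented.mk_eq_zero (rels := ellipticRels a c B C)
    (Set.mem_insert_of_mem _ (Set.mem_insert _ _))
  simp only [map_sub, map_add, map_smul, map_mul, Presented.mk_ι, pow_two] at this
  rw [← sub_eq_zero, ← this]
  module

/-- The homomorphism `x ↦ x + l y`, `y ↦ y`, `z ↦ w + x + (l - (a - 1)) y`. -/
def ellipticToT (hB : B = 2 - 2 * l) (hg : g = C + 2 * (a - 1) - l ^ 2)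
    (hh : h = c - (a - 1) * (C + a - 1)) : Presented (ellipticRels a c B C) →ₐ[k] T g h :=
  -- In E put w = z - x + (a - 1) y. Then the first relation collapses to w² = -h y². In the second,
  -- shifting x by l y with 2l = 2 - B removes the xy term and leaves g as the coefficient of y².
  Presented.lift ![x g h + l • y g h, y g h, w g h + x g h + (l - (a - 1)) • y g h] <| by
    have h1 := y_mul_x g h
    have h2 := w_mul_y g h
    have h3 := w_mul_w g h
    rintro r (rfl | rfl | rfl) <;>
    simp only [map_sub, map_add, map_smul, map_mul, FreeAlgebra.lift_ι_apply, pow_two,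
      Matrix.cons_val, mul_add, add_mul, smul_mul_assoc, mul_smul_comm, h1, h2, h3]
    · subst hB; obtain rfl : c = h + (a - 1) * (C + a - 1) := by rw [hh]; ring
      subst hg
      module
    · subst hB hg
      module
    · module

/-- The homomorphism `x ↦ x - l y`, `y ↦ y`, `w ↦ z - x + (a - 1) y`. -/
def ellipticOfT (hB : B = 2 - 2 * l) (hg : g = C + 2 * (a - 1) - l ^ 2)
    (hh : h = c - (a - 1) * (C + a - 1)) : T g h →ₐ[k] Presented (ellipticRels a c B C) :=
  Presented.lift ![gen (ellipticRels a c B C) 0 - l • gen (ellipticRels a c B C) 1,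
      gen (ellipticRels a c B C) 1, gen (ellipticRels a c B C) 2 - gen (ellipticRels a c B C) 0 +
        (a - 1) • gen (ellipticRels a c B C) 1] <| by
    have h1 := gen_one_mul_gen_zero a c B C
    have h2 := gen_two_mul_gen_zero a c B C
    have h3 := gen_two_mul_gen_one a c B C
    rintro r (rfl | rfl | rfl) <;>
    simp only [map_sub, map_add, map_smul, map_mul, FreeAlgebra.lift_ι_apply, pow_two,
      Matrix.cons_val, mul_add, add_mul, mul_sub, sub_mul, smul_mul_assoc, mul_smul_comm,
      h1, h2, h3]
    · subst hB hg
      module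
    · subst hB hh
      module
    · module

/-- The elliptic-type algebra is isomorphic to `T(g, h)`. -/
def ellipticEquivT (hB : B = 2 - 2 * l) (hg : g = C + 2 * (a - 1) - l ^ 2)
    (hh : h = c - (a - 1) * (C + a - 1)) : Presented (ellipticRels a c B C) ≃ₐ[k] T g h :=
  AlgEquiv.ofAlgHom (ellipticToT hB hg hh) (ellipticOfT hB hg hh)
    (by
      refine Presented.algHom_ext fun i => ?_
      fin_cases i <;>
      simp [ellipticToT, ellipticOfT, x, y, w]; module)
    (by
      refine Presented.algHom_ext fun i => ?_
      fin_cases i <;>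
      simp [ellipticToT, ellipticOfT, x, y, w]; module)

theorem ellipticEquivT_gen_zero (hB : B = 2 - 2 * l) (hg : g = C + 2 * (a - 1) - l ^ 2)
    (hh : h = c - (a - 1) * (C + a - 1)) :
    ellipticEquivT hB hg hh (gen (ellipticRels a c B C) 0) = x g h + l • y g h :=
  Presented.lift_gen _ _ _

theorem ellipticEquivT_gen_one (hB : B = 2 - 2 * l) (hg : g = C + 2 * (a - 1) - l ^ 2)
    (hh : h = c - (a - 1) * (C + a - 1)) :
    ellipticEquivT hB hg hh (gen (ellipticRels a c B C) 1) = y g h :=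
  Presented.lift_gen _ _ _

theorem ellipticEquivT_gen_two (hB : B = 2 - 2 * l) (hg : g = C + 2 * (a - 1) - l ^ 2)
    (hh : h = c - (a - 1) * (C + a - 1)) :
    ellipticEquivT hB hg hh (gen (ellipticRels a c B C) 2) =
      w g h + x g h + (l - (a - 1)) • y g h :=
  Presented.lift_gen _ _ _

theorem map_wordGrading_le {rels rels' : Set (FreeAlgebra k (Fin 3))}
    (φ : Presented rels →ₐ[k] Presented rels')
    (hφ : ∀ i, φ (gen rels i) ∈ Submodule.span k (Set.range (gen rels'))) (n : ℕ) :
    (wordGrading rels n).map φ.toLinearMap ≤ wordGrading rels' n := by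
  rw [wordGrading, Submodule.map_pow, Submodule.map_span, wordGrading]
  refine pow_le_pow_left' (Submodule.span_le.2 ?_) n
  rintro _ ⟨_, ⟨i, rfl⟩, rfl⟩
  exact hφ i

/-- The isomorphism and its inverse are linear in the generators, so each preserves word length. -/
theorem map_ellipticEquivT (hB : B = 2 - 2 * l) (hg : g = C + 2 * (a - 1) - l ^ 2)
    (hh : h = c - (a - 1) * (C + a - 1)) (n : ℕ) :
    (wordGrading (ellipticRels a c B C) n).map (ellipticEquivT hB hg hh).toLinearMap =
      gradingT g h n := by
  have hm : ∀ (rels : Set (FreeAlgebra k (Fin 3))) (i : Fin 3),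
      gen rels i ∈ Submodule.span k (Set.range (gen rels)) :=
    fun rels i => Submodule.subset_span ⟨i, rfl⟩
  refine le_antisymm (map_wordGrading_le (ellipticToT hB hg hh) (fun i => ?_) n) ?_
  · have hm' := hm (weierstrassRels g h)
    fin_cases i <;> simp only [ellipticToT, Presented.lift_gen]
    · exact add_mem (hm' 0) (Submodule.smul_mem _ _ (hm' 1))
    · exact hm' 1
    · exact add_mem (add_mem (hm' 2) (hm' 0)) (Submodule.smul_mem _ _ (hm' 1))
  · have hm' := hm (ellipticRels a c B C)
    have := map_wordGrading_le (ellipticOfT hB hg hh) (fun i => ?_) n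
    · intro t ht
      exact ⟨_, this ⟨t, ht, rfl⟩, (ellipticEquivT hB hg hh).apply_symm_apply t⟩
    · fin_cases i <;> simp only [ellipticOfT, Presented.lift_gen]
      · exact sub_mem (hm' 0) (Submodule.smul_mem _ _ (hm' 1))
      · exact hm' 1
      · exact add_mem (sub_mem (hm' 2) (hm' 0)) (Submodule.smul_mem _ _ (hm' 1))

end EllipticIso

/-! ### Polynomial evaluation at commuting elements -/

section CommutingFamilies

variable {k : Type u} [Field k] {σ A : Type*} [Ring A] [Algebra k A]

open scoped IsMulCommutative in
/-- Evaluation of polynomials at a family of commuting elements of a noncommutative algebra. -/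
def aevalOfComm (f : σ → A) (hf : ∀ i j, f i * f j = f j * f i) : MvPolynomial σ k →ₐ[k] A :=
  have : IsMulCommutative (Algebra.adjoin k (Set.range f)) :=
    Algebra.isMulCommutative_adjoin k <| by
      rintro _ ⟨i, rfl⟩ _ ⟨j, rfl⟩
      exact hf i j
  (Algebra.adjoin k (Set.range f)).val.comp
    (MvPolynomial.aeval fun i => ⟨f i, Algebra.subset_adjoin ⟨i, rfl⟩⟩)

@[simp]
theorem aevalOfComm_X (f : σ → A) (hf : ∀ i j, f i * f j = f j * f i) (i : σ) :
    aevalOfComm (k := k) f hf (MvPolynomial.X i) = f i := by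
  simp [aevalOfComm]

end CommutingFamilies

/-! ### T as a free left module of rank four over k[x², y², z] -/

section Model

open MvPolynomial

variable {k : Type u} [Field k] (g h r : k)

/-- The element `w + x + r y`, which satisfies `zx + xz = z² + p` and `zy + yz = 2xy + q` for
central elements `p` and `q`. -/
def z : T g h := w g h + x g h + r • y g h

theorem commute_z_sq_x : Commute (z g h r) (x g h * x g h) := by
  have h1 : Commute (x g h) (x g h * x g h) := (Commute.refl _).mul_right (Commute.refl _)
  exact ((commute_w_sq_x g h).add_left h1).add_left ((commute_y_sq_x g h).smul_left r)

theorem commute_z_sq_y : Commute (z g h r) (y g h * y g h) := by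
  have h1 : Commute (y g h) (y g h * y g h) := (Commute.refl _).mul_right (Commute.refl _)
  have h2 : Commute (x g h) (y g h) := (y_mul_x g h).symm
  exact ((commute_w_sq_y g h).add_left (h2.mul_right h2)).add_left (h1.smul_left r)

/-- This is the relation for w² in terms of z. Read from left to right, it moves z to the front. -/
theorem x_mul_z : x g h * z g h r = -(z g h r * x g h) + z g h r * z g h r +
    ((1 - r) • (x g h * x g h) + (h - r ^ 2 - r * g) • (y g h * y g h)) := by
  have h1 := y_mul_x g h
  have h2 := w_mul_y g h
  have h3 := w_mul_w g h
  simp only [z, mul_add, add_mul, smul_mul_assoc, mul_smul_comm, h1, h2, h3]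
  module

theorem y_mul_z : y g h * z g h r = -(z g h r * y g h) + 2 • (x g h * y g h) +
    (x g h * x g h + (g + 2 * r) • (y g h * y g h)) := by
  have h1 := y_mul_x g h
  have h2 := w_mul_y g h
  simp only [z, mul_add, add_mul, smul_mul_assoc, mul_smul_comm, h1, h2]
  module

/-- The polynomial `p` with `zx + xz = z² + p`. -/
def modelP : MvPolynomial (Fin 3) k := C (1 - r) * X 0 + C (h - r ^ 2 - r * g) * X 1

/-- The polynomial `q` with `zy + yz = 2xy + q`. -/
def modelQ : MvPolynomial (Fin 3) k := X 0 + C (g + 2 * r) * X 1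

/-- Right multiplication by `x` in the basis `1, x, y, xy` of `T` over `k[x², y², z]`. -/
def modelX (k : Type u) [Field k] : Matrix (Fin 4) (Fin 4) (MvPolynomial (Fin 3) k) :=
  !![0, 1, 0, 0; X 0, 0, 0, 0; 0, 0, 0, 1; 0, 0, X 0, 0]

/-- Right multiplication by `y` in the basis `1, x, y, xy` of `T` over `k[x², y², z]`. -/
def modelY (k : Type u) [Field k] : Matrix (Fin 4) (Fin 4) (MvPolynomial (Fin 3) k) :=
  !![0, 0, 1, 0; 0, 0, 0, 1; X 1, 0, 0, 0; 0, X 1, 0, 0]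

/-- Right multiplication by `z` in the basis `1, x, y, xy` of `T` over `k[x², y², z]`. -/
def modelZ : Matrix (Fin 4) (Fin 4) (MvPolynomial (Fin 3) k) :=
  !![X 2, 0, 0, 0;
     X 2 ^ 2 + modelP g h r, -X 2, 0, 0;
     modelQ g r, 0, -X 2, 2;
     0, modelQ g r, 2 * X 0 - X 2 ^ 2 - modelP g h r, X 2]

/-- The representation of `T` by right multiplications on the free module with basis
`1, x, y, xy` over `k[x², y², z]`. -/
def rep : T g h →ₐ[k] Matrix (Fin 4) (Fin 4) (MvPolynomial (Fin 3) k) :=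
  Presented.lift ![modelX k, modelY k, modelZ g h r - modelX k - r • modelY k] <| by
    rintro _ (rfl | rfl | rfl) <;>
    simp only [map_sub, map_add, map_smul, map_mul, FreeAlgebra.lift_ι_apply, pow_two,
      Matrix.cons_val]
    all_goals
      ext1 i j
      simp only [Matrix.mul_apply, Matrix.sub_apply, Matrix.add_apply, Matrix.smul_apply,
        Fin.sum_univ_four, smul_eq_C_mul, Matrix.zero_apply]
      fin_cases i <;> fin_cases j <;>
      simp only [modelX, modelY, modelZ, modelP, modelQ, Matrix.of_apply, Matrix.cons_val,
        Fin.zero_eta, Fin.mk_one, Fin.reduceFinMk, map_sub, map_add, map_mul, map_pow, map_one,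
        map_ofNat] <;>
      ring

theorem rep_x : rep g h r (x g h) = modelX k := Presented.lift_gen _ _ _

theorem rep_y : rep g h r (y g h) = modelY k := Presented.lift_gen _ _ _

theorem rep_w : rep g h r (w g h) = modelZ g h r - modelX k - r • modelY k :=
  Presented.lift_gen _ _ _

theorem rep_z : rep g h r (z g h r) = modelZ g h r := by
  rw [z, map_add, map_add, map_smul, rep_x, rep_y, rep_w]
  abel

/-- The coordinates of an element of `T` in the basis `1, x, y, xy` over `k[x², y², z]`. -/
def coord : T g h →ₗ[k] (Fin 4 → MvPolynomial (Fin 3) k) :=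
  LinearMap.proj 0 ∘ₗ (rep g h r).toLinearMap

/-- Coordinates are the row of `rep` belonging to the basis element 1, so multiplicativity of `rep`
gives the rule for right multiplication. -/
theorem coord_mul (s t : T g h) :
    coord g h r (s * t) = Matrix.vecMul (coord g h r s) (rep g h r t) := by
  change rep g h r (s * t) 0 = Matrix.vecMul (rep g h r s 0) (rep g h r t)
  rw [map_mul]
  rfl

theorem coord_one : coord g h r 1 = ![1, 0, 0, 0] := by
  change rep g h r 1 0 = _
  rw [map_one]
  ext1 i
  fin_cases i <;> rfl

/-- The homomorphism `k[X, Y, Z] → T`, `X ↦ x²`, `Y ↦ y²`, `Z ↦ z`. -/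
def polyMap : MvPolynomial (Fin 3) k →ₐ[k] T g h :=
  aevalOfComm ![x g h * x g h, y g h * y g h, z g h r] <| by
    have h1 := (commute_z_sq_x g h r).eq
    have h2 := (commute_z_sq_y g h r).eq
    have h3 : x g h * x g h * (y g h * y g h) = y g h * y g h * (x g h * x g h) :=
      ((commute_y_sq_x g h).mul_left (commute_y_sq_x g h)).eq.symm
    intro i j
    fin_cases i <;> fin_cases j <;> simp [h1, h2, h3]

theorem polyMap_X_zero : polyMap g h r (X 0) = x g h * x g h := aevalOfComm_X _ _ _

theorem polyMap_X_one : polyMap g h r (X 1) = y g h * y g h := aevalOfComm_X _ _ _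

theorem polyMap_X_two : polyMap g h r (X 2) = z g h r := aevalOfComm_X _ _ _

theorem polyMap_C (c : k) : polyMap g h r (C c) = algebraMap k _ c :=
  (polyMap g h r).commutes c

/-- The element of `T` with given coordinates. -/
def ofCoord : (Fin 4 → MvPolynomial (Fin 3) k) →ₗ[k] T g h where
  toFun v := polyMap g h r (v 0) + polyMap g h r (v 1) * x g h + polyMap g h r (v 2) * y g h +
    polyMap g h r (v 3) * (x g h * y g h)
  map_add' v v' := by simp only [Pi.add_apply, map_add, add_mul]; abel
  map_smul' c v := by
    simp only [Pi.smul_apply, map_smul, smul_mul_assoc, RingHom.id_apply, smul_add]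

theorem ofCoord_apply (v : Fin 4 → MvPolynomial (Fin 3) k) :
    ofCoord g h r v = polyMap g h r (v 0) + polyMap g h r (v 1) * x g h +
      polyMap g h r (v 2) * y g h + polyMap g h r (v 3) * (x g h * y g h) := rfl

theorem coord_polyMap (s : MvPolynomial (Fin 3) k) :
    coord g h r (polyMap g h r s) = ![s, 0, 0, 0] := by
  induction s using MvPolynomial.induction_on with
  | C c =>
    rw [polyMap_C, Algebra.algebraMap_eq_smul_one, map_smul, coord_one]
    ext1 i
    fin_cases i <;> simp [smul_eq_C_mul]
  | add p q hp hq => rw [map_add, map_add, hp, hq]; simp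
  | mul_X p i hp =>
    rw [map_mul, coord_mul, hp]
    have : rep g h r (polyMap g h r (X i)) 0 = ![X i, 0, 0, 0] := by
      fin_cases i
      · change rep g h r (polyMap g h r (X 0)) 0 = ![X 0, 0, 0, 0]
        rw [polyMap_X_zero, map_mul, rep_x]
        ext1 j
        fin_cases j <;> simp [Matrix.mul_apply, Fin.sum_univ_four, modelX]
      · change rep g h r (polyMap g h r (X 1)) 0 = ![X 1, 0, 0, 0]
        rw [polyMap_X_one, map_mul, rep_y]
        ext1 j
        fin_cases j <;> simp [Matrix.mul_apply, Fin.sum_univ_four, modelY]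
      · change rep g h r (polyMap g h r (X 2)) 0 = ![X 2, 0, 0, 0]
        rw [polyMap_X_two, rep_z]
        rfl
    ext1 j
    have hj := congrFun this j
    simp only [Matrix.vecMul, dotProduct, Fin.sum_univ_four, Matrix.cons_val, zero_mul, add_zero,
      hj]
    fin_cases j <;> simp

/-- This is the independence of 1, x, y, xy over k[x², y², z]. In the matrix model the four basis
elements act on the first basis vector by the four basis vectors. -/
theorem coord_ofCoord (v : Fin 4 → MvPolynomial (Fin 3) k) :
    coord g h r (ofCoord g h r v) = v := by
  rw [ofCoord_apply]
  simp only [map_add, coord_mul, coord_polyMap, rep_x, rep_y, map_mul]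
  ext1 j
  fin_cases j <;>
  simp [modelX, modelY]

theorem ofCoord_vecMul_modelX (v : Fin 4 → MvPolynomial (Fin 3) k) :
    ofCoord g h r (Matrix.vecMul v (modelX k)) = ofCoord g h r v * x g h := by
  have h1 := y_mul_x g h
  simp only [ofCoord_apply, Matrix.vecMul, dotProduct, Fin.sum_univ_four, modelX, Matrix.of_apply,
    Matrix.cons_val, mul_zero, add_zero, zero_add, mul_one, map_mul, polyMap_X_zero, add_mul,
    mul_assoc, h1]
  abel

theorem ofCoord_vecMul_modelY (v : Fin 4 → MvPolynomial (Fin 3) k) :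
    ofCoord g h r (Matrix.vecMul v (modelY k)) = ofCoord g h r v * y g h := by
  have h1 : y g h * (y g h * x g h) = x g h * (y g h * y g h) := by
    rw [y_mul_x, ← mul_assoc, y_mul_x, mul_assoc]
  simp only [ofCoord_apply, Matrix.vecMul, dotProduct, Fin.sum_univ_four, modelY, Matrix.of_apply,
    Matrix.cons_val, mul_zero, add_zero, zero_add, mul_one, map_mul, polyMap_X_one, add_mul,
    mul_assoc, h1]
  abel

/-- The rows of `modelZ` are the normal forms of z, xz, yz and xyz obtained by moving z to the left.
-/
theorem ofCoord_vecMul_modelZ (v : Fin 4 → MvPolynomial (Fin 3) k) :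
    ofCoord g h r (Matrix.vecMul v (modelZ g h r)) = ofCoord g h r v * z g h r := by
  have h1 := x_mul_z g h r
  have h2 := y_mul_z g h r
  have hp : polyMap g h r (modelP g h r) =
      (1 - r) • (x g h * x g h) + (h - r ^ 2 - r * g) • (y g h * y g h) := by
    simp only [modelP, map_add, map_mul, polyMap_C, polyMap_X_zero, polyMap_X_one, Algebra.smul_def]
  have hq : polyMap g h r (modelQ g r) = x g h * x g h + (g + 2 * r) • (y g h * y g h) := by
    simp only [modelQ, map_add, map_mul, polyMap_C, polyMap_X_zero, polyMap_X_one, Algebra.smul_def]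
  have hqx : polyMap g h r (modelQ g r) * x g h = x g h * polyMap g h r (modelQ g r) := by
    have h3 : Commute (x g h) (x g h * x g h) := (Commute.refl _).mul_right (Commute.refl _)
    have h4 : Commute (x g h) (y g h) := (y_mul_x g h).symm
    rw [hq]
    exact (h3.add_right ((h4.mul_right h4).smul_right _)).eq.symm
  rw [← hp] at h1
  rw [← hq] at h2
  -- Here z moves first past y, then past x. The x² produced by the first move accounts for the
  -- entry 2X - Z² - p.
  have h3 : x g h * y g h * z g h r = polyMap g h r (modelQ g r) * x g h +
      (2 • (x g h * x g h) - z g h r * z g h r - polyMap g h r (modelP g h r)) * y g h +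
      z g h r * (x g h * y g h) := by
    rw [mul_assoc, h2, hqx]
    simp only [mul_add, mul_neg, ← mul_assoc, h1, sub_mul, add_mul, mul_smul_comm, smul_mul_assoc,
      neg_mul]
    abel
  rw [ofCoord_apply, ofCoord_apply]
  simp only [add_mul, mul_assoc]
  rw [← mul_assoc (x g h) (y g h), h1, h2, h3]
  simp only [Matrix.vecMul, dotProduct, Fin.sum_univ_four, modelZ, Matrix.of_apply,
    Matrix.cons_val, mul_zero, add_zero, zero_add, map_mul, map_add, map_sub, map_neg,
    map_ofNat, polyMap_X_two, polyMap_X_zero, pow_two]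
  simp only [mul_add, mul_sub, mul_neg, neg_mul, add_mul, sub_mul, mul_assoc, nsmul_eq_mul, Nat.cast_ofNat]
  abel

/-- This is the spanning half. `ofCoord` intertwines the matrix action with right multiplication,
and the claim is the image of this at the element 1. -/
theorem ofCoord_coord (t : T g h) : ofCoord g h r (coord g h r t) = t := by
  -- The row `v` is arbitrary so that the induction passes through products.
  have key : ∀ (t : T g h) (v : Fin 4 → MvPolynomial (Fin 3) k),
      ofCoord g h r (Matrix.vecMul v (rep g h r t)) = ofCoord g h r v * t := by
    intro t
    induction t using Presented.induction with
    | algebraMap c =>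
      intro v
      rw [AlgHom.commutes, Algebra.algebraMap_eq_smul_one, Matrix.vecMul_smul, Matrix.vecMul_one,
        map_smul, Algebra.algebraMap_eq_smul_one, mul_smul_comm, mul_one]
    | gen i =>
      intro v
      fin_cases i
      · change ofCoord g h r (Matrix.vecMul v (rep g h r (x g h))) = _ * x g h
        rw [rep_x, ofCoord_vecMul_modelX]
      · change ofCoord g h r (Matrix.vecMul v (rep g h r (y g h))) = _ * y g h
        rw [rep_y, ofCoord_vecMul_modelY]
      · change ofCoord g h r (Matrix.vecMul v (rep g h r (w g h))) = _ * w g h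
        have hw : w g h = z g h r - x g h - r • y g h := by rw [z]; abel
        rw [rep_w, hw, Matrix.vecMul_sub, Matrix.vecMul_sub, Matrix.vecMul_smul, map_sub, map_sub,
          map_smul, ofCoord_vecMul_modelX, ofCoord_vecMul_modelY, ofCoord_vecMul_modelZ]
        simp only [mul_sub, mul_smul_comm]
    | add a b ha hb =>
      intro v
      rw [map_add, Matrix.vecMul_add, map_add, ha, hb, mul_add]
    | mul a b ha hb =>
      intro v
      rw [map_mul, ← Matrix.vecMul_vecMul, hb, ha, mul_assoc]
  have h1 : coord g h r t = Matrix.vecMul (coord g h r 1) (rep g h r t) := by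
    rw [← coord_mul, one_mul]
  have h2 : ofCoord g h r (coord g h r 1) = 1 := by
    rw [coord_one, ofCoord_apply]
    simp
  rw [h1, key, h2, one_mul]

theorem coord_injective : Function.Injective (coord g h r) :=
  Function.LeftInverse.injective (ofCoord_coord g h r)

end Model

/-! ### Variables as regular sequences in polynomial rings -/

section Coprime

open MvPolynomial

variable {k σ : Type*} [Field k]

/-- Membership in an ideal generated by variables is tested monomial by monomial, and multiplication
by another variable does not affect divisibility by those in `s`. -/
theorem mem_span_X_of_X_mul_mem {s : Set σ} {i : σ} (hi : i ∉ s) {f : MvPolynomial σ k}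
    (hf : X i * f ∈ Ideal.span (X '' s : Set (MvPolynomial σ k))) :
    f ∈ Ideal.span (X '' s : Set (MvPolynomial σ k)) := by
  classical
  rw [mem_ideal_span_X_image] at hf ⊢
  intro m hm
  obtain ⟨j, hj, hmj⟩ := hf (Finsupp.single i 1 + m) (by
    rw [support_X_mul]
    exact Finset.mem_map_of_mem (addLeftEmbedding (Finsupp.single i 1)) hm)
  refine ⟨j, hj, ?_⟩
  have hij : i ≠ j := fun h => hi (h ▸ hj)
  simpa [Finsupp.single_apply, hij] using hmj

/-- Two different variables form a regular sequence. -/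
theorem exists_of_X_mul_add_X_mul_eq_zero {i j : σ} (hij : i ≠ j) {u v : MvPolynomial σ k}
    (huv : X i * u + X j * v = 0) : ∃ e, u = X j * e ∧ v = -(X i * e) := by
  have hu : u ∈ Ideal.span (X '' ({j} : Set σ) : Set (MvPolynomial σ k)) := by
    refine mem_span_X_of_X_mul_mem (i := i) (by simpa using hij) ?_
    rw [Set.image_singleton, Ideal.mem_span_singleton]
    exact ⟨-v, by linear_combination huv⟩
  rw [Set.image_singleton, Ideal.mem_span_singleton] at hu
  obtain ⟨e, rfl⟩ := hu
  refine ⟨e, rfl, ?_⟩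
  have : (X j : MvPolynomial σ k) ≠ 0 := X_ne_zero j
  refine mul_left_cancel₀ this ?_
  linear_combination huv

end Coprime

/-! ### Left syzygies of x, y, w, computed in coordinates with r = 0 -/

section Annihilators

open MvPolynomial

variable {k : Type u} [Field k] {g h : k}

theorem coord_mul_x (t : T g h) : coord g h 0 (t * x g h) =
    ![X 0 * coord g h 0 t 1, coord g h 0 t 0, X 0 * coord g h 0 t 3, coord g h 0 t 2] := by
  rw [coord_mul, rep_x]
  ext1 j
  fin_cases j <;> simp [Matrix.vecMul, dotProduct, Fin.sum_univ_four, modelX, mul_comm]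

theorem coord_mul_y (t : T g h) : coord g h 0 (t * y g h) =
    ![X 1 * coord g h 0 t 2, X 1 * coord g h 0 t 3, coord g h 0 t 0, coord g h 0 t 1] := by
  rw [coord_mul, rep_y]
  ext1 j
  fin_cases j <;> simp [Matrix.vecMul, dotProduct, Fin.sum_univ_four, modelY, mul_comm]

theorem coord_mul_w (t : T g h) : coord g h 0 (t * w g h) =
    ![X 2 * coord g h 0 t 0 + (X 2 ^ 2 + C h * X 1) * coord g h 0 t 1 +
        (X 0 + C g * X 1) * coord g h 0 t 2,
      -coord g h 0 t 0 - X 2 * coord g h 0 t 1 + (X 0 + C g * X 1) * coord g h 0 t 3,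
      -(X 2 * coord g h 0 t 2) - (X 2 ^ 2 + C h * X 1) * coord g h 0 t 3,
      coord g h 0 t 2 + X 2 * coord g h 0 t 3] := by
  rw [coord_mul, rep_w]
  ext1 j
  fin_cases j <;>
  simp [Matrix.vecMul, dotProduct, Fin.sum_univ_four, modelX, modelY, modelZ, modelP, modelQ] <;>
  ring

theorem ext_coord {s t : T g h} (h0 : coord g h 0 s 0 = coord g h 0 t 0)
    (h1 : coord g h 0 s 1 = coord g h 0 t 1) (h2 : coord g h 0 s 2 = coord g h 0 t 2)
    (h3 : coord g h 0 s 3 = coord g h 0 t 3) : s = t := by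
  refine coord_injective g h 0 (funext fun j => ?_)
  fin_cases j <;> assumption

theorem eq_zero_of_mul_y_eq_zero {t : T g h} (ht : t * y g h = 0) : t = 0 := by
  have hc := coord_mul_y t
  rw [ht, map_zero] at hc
  have h0 := congrFun hc.symm 0
  have h1 := congrFun hc.symm 1
  have h2 := congrFun hc.symm 2
  have h3 := congrFun hc.symm 3
  simp [X_ne_zero] at h0 h1 h2 h3
  refine ext_coord ?_ ?_ ?_ ?_ <;> simp [h0, h1, h2, h3]

/-- Multiplying by w once more gives h t y² = 0, and y can be cancelled on the right. -/
theorem eq_zero_of_mul_w_eq_zero (hh : h ≠ 0) {t : T g h} (ht : t * w g h = 0) : t = 0 := by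
  have h1 : h • (t * y g h * y g h) = 0 := by
    have : t * w g h * w g h = 0 := by rw [ht, zero_mul]
    rwa [mul_assoc, w_mul_w, mul_neg, neg_eq_zero, mul_smul_comm, ← mul_assoc] at this
  have h2 := (smul_eq_zero.1 h1).resolve_left hh
  exact eq_zero_of_mul_y_eq_zero (eq_zero_of_mul_y_eq_zero h2)

/-- Three of the four coordinate equations identify coordinates of c directly. Only the first needs
that X and Y form a regular sequence, which supplies the last coordinate. -/
theorem exists_of_mul_x_add_mul_y_eq_zero {a b : T g h} (hab : a * x g h + b * y g h = 0) :
    ∃ c, a = -(c * y g h) ∧ b = c * x g h := by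
  have hc := congrArg (coord g h 0) hab
  rw [map_add, coord_mul_x, coord_mul_y, map_zero] at hc
  have h0 := congrFun hc 0
  have h1 := congrFun hc 1
  have h2 := congrFun hc 2
  have h3 := congrFun hc 3
  simp only [Pi.add_apply, Matrix.cons_val, Pi.zero_apply] at h0 h1 h2 h3
  obtain ⟨e, he1, he2⟩ := exists_of_X_mul_add_X_mul_eq_zero (by decide) h0
  refine ⟨ofCoord g h 0 ![coord g h 0 b 1, -coord g h 0 a 3, coord g h 0 b 3, -e], ?_, ?_⟩
  · refine ext_coord ?_ ?_ ?_ ?_ <;>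
    simp only [map_neg, coord_mul_y, coord_ofCoord, Matrix.cons_val, Pi.neg_apply]
    · linear_combination h1
    · linear_combination he1
    · linear_combination h3
    · ring
  · refine ext_coord ?_ ?_ ?_ ?_ <;>
    simp only [coord_mul_x, coord_ofCoord, Matrix.cons_val]
    · linear_combination h2
    · linear_combination he2

/-- Modulo (X, Y) the first coordinate of the equation reads Z (a₀ + Z a₁) = 0, so a₀ + Z a₁ = u X +
v Y. This is the only obstruction to writing a in T y + T w. -/
theorem exists_of_mul_w_eq {a b c : T g h} (habc : a * w g h = b * x g h + c * y g h) :
    ∃ s t, a = s * y g h + t * w g h := by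
  have hc := congrArg (coord g h 0) habc
  rw [map_add, coord_mul_x, coord_mul_y, coord_mul_w] at hc
  have h0 := congrFun hc 0
  simp only [Pi.add_apply, Matrix.cons_val] at h0
  have hm : coord g h 0 a 0 + X 2 * coord g h 0 a 1 ∈
      Ideal.span (X '' {0, 1} : Set (MvPolynomial (Fin 3) k)) := by
    refine mem_span_X_of_X_mul_mem (i := 2) (by simp) ?_
    rw [Set.image_pair, Ideal.mem_span_pair]
    exact ⟨coord g h 0 b 1 - coord g h 0 a 2,
      coord g h 0 c 2 - C h * coord g h 0 a 1 - C g * coord g h 0 a 2, by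
        linear_combination -h0⟩
  rw [Set.image_pair, Ideal.mem_span_pair] at hm
  obtain ⟨u, v, huv⟩ := hm
  let t : T g h := ofCoord g h 0 ![-coord g h 0 a 1, 0, u, 0]
  -- The element t w has coordinate 1 equal to a₁ and contributes u X in coordinate 0. The
  -- coordinates of s are then forced by comparing with a.
  refine ⟨ofCoord g h 0 ![coord g h 0 a 2 + X 2 * u, coord g h 0 a 3 - u, v - C g * u, 0], t, ?_⟩
  refine ext_coord ?_ ?_ ?_ ?_ <;>
  simp only [t, map_add, coord_mul_y, coord_mul_w, coord_ofCoord, Matrix.cons_val, Pi.add_apply]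
  · linear_combination -huv
  all_goals ring

/-- The solutions for every h are parametrized by the free coordinates a₃, b₁, b₃ and one further
polynomial e. Adding Z times the second equation to the first eliminates b₀ and leaves a syzygy of
(X, Y), which is where e comes from. -/
theorem exists_coord_of_mul_y_add_mul_w_eq_zero {a b : T g h}
    (hab : a * y g h + b * w g h = 0) : ∃ e,
    coord g h 0 a 0 = X 1 * (X 2 * e + C h * coord g h 0 b 3) ∧
    coord g h 0 a 1 = -(X 1 * e) ∧
    coord g h 0 a 2 = -(X 2 * coord g h 0 a 3) - C h * coord g h 0 b 1 -
      (X 0 + C g * X 1) * e ∧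
    coord g h 0 b 0 = X 1 * coord g h 0 a 3 - X 2 * coord g h 0 b 1 +
      (X 0 + C g * X 1) * coord g h 0 b 3 ∧
    coord g h 0 b 2 = X 1 * e - X 2 * coord g h 0 b 3 := by
  have hc := congrArg (coord g h 0) hab
  rw [map_add, coord_mul_y, coord_mul_w, map_zero] at hc
  have h0 := congrFun hc 0
  have h1 := congrFun hc 1
  have h2 := congrFun hc 2
  have h3 := congrFun hc 3
  simp only [Pi.add_apply, Matrix.cons_val, Pi.zero_apply] at h0 h1 h2 h3
  obtain ⟨e, he1, he2⟩ := exists_of_X_mul_add_X_mul_eq_zero (i := (0 : Fin 3)) (j := 1)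
    (u := coord g h 0 b 2 + X 2 * coord g h 0 b 3)
    (v := coord g h 0 a 2 + X 2 * coord g h 0 a 3 + C h * coord g h 0 b 1 +
      C g * (coord g h 0 b 2 + X 2 * coord g h 0 b 3)) (by decide)
    (by linear_combination h0 + X 2 * h1)
  refine ⟨e, ?_, ?_, ?_, ?_, ?_⟩
  · linear_combination h2 + X 2 * he1
  · linear_combination h3 - he1
  · linear_combination he2 - C g * he1
  · linear_combination -h1
  · linear_combination he1

/-- Coordinates of c are read off from a = h c y by dividing by h. The coordinate expected from a₀
simplifies because a₀ is Y times an explicit polynomial. -/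
theorem exists_of_mul_y_add_mul_w_eq_zero (hh : h ≠ 0) {a b : T g h}
    (hab : a * y g h + b * w g h = 0) : ∃ c, a = h • (c * y g h) ∧ b = c * w g h := by
  obtain ⟨e, ha0, ha1, ha2, hb0, hb2⟩ := exists_coord_of_mul_y_add_mul_w_eq_zero hab
  have hC : (C h * C h⁻¹ : MvPolynomial (Fin 3) k) = 1 := by
    rw [← C_mul, mul_inv_cancel₀ hh, C_1]
  refine ⟨ofCoord g h 0 ![C h⁻¹ * coord g h 0 a 2, C h⁻¹ * coord g h 0 a 3,
    C h⁻¹ * (X 2 * e) + coord g h 0 b 3, -(C h⁻¹ * e)], ?_, ?_⟩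
  · refine ext_coord ?_ ?_ ?_ ?_ <;>
    simp only [map_smul, coord_mul_y, coord_ofCoord, Matrix.cons_val, Pi.smul_apply, smul_eq_C_mul]
    · linear_combination ha0 - X 1 * X 2 * e * hC
    · linear_combination ha1 + X 1 * e * hC
    · linear_combination -coord g h 0 a 2 * hC
    · linear_combination -coord g h 0 a 3 * hC
  · refine ext_coord ?_ ?_ ?_ ?_ <;>
    simp only [coord_mul_w, coord_ofCoord, Matrix.cons_val]
    · linear_combination hb0 - X 2 * C h⁻¹ * ha2 +
        (X 2 * coord g h 0 b 1 - X 1 * coord g h 0 a 3) * hC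
    · linear_combination C h⁻¹ * ha2 - coord g h 0 b 1 * hC
    · linear_combination hb2 - X 1 * e * hC
    · ring

/-- The two families come from w² = 0 and from the centrality of y². With h = 0 the parameters b₁,
b₃ no longer occur in a and determine s, while a₃ and e determine t. -/
theorem exists_of_mul_y_add_mul_w_eq_zero' {a b : T g 0}
    (hab : a * y g 0 + b * w g 0 = 0) :
    ∃ s t, a = t * (w g 0 * y g 0) ∧ b = s * w g 0 - t * (y g 0 * y g 0) := by
  obtain ⟨e, ha0, ha1, ha2, hb0, hb2⟩ := exists_coord_of_mul_y_add_mul_w_eq_zero hab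
  rw [C_0] at ha0 ha2
  let s : T g 0 := ofCoord g 0 0 ![-coord g 0 0 b 1, 0, coord g 0 0 b 3, 0]
  let t : T g 0 := ofCoord g 0 0 ![-coord g 0 0 a 3, 0, -e, 0]
  refine ⟨s, t, ?_, ?_⟩
  · rw [← mul_assoc]
    refine ext_coord ?_ ?_ ?_ ?_ <;>
    simp only [t, coord_mul_w, coord_mul_y, coord_ofCoord, Matrix.cons_val, C_0]
    · linear_combination ha0
    · linear_combination ha1
    · linear_combination ha2
    · ring
  · rw [← mul_assoc]
    refine ext_coord ?_ ?_ ?_ ?_ <;>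
    simp only [s, t, map_sub, coord_mul_w, coord_mul_y, coord_ofCoord, Matrix.cons_val, C_0,
      Pi.sub_apply]
    · linear_combination hb0
    · ring
    · linear_combination hb2
    · ring

/-- Coordinates 1 and 3 of the equation express t₀ and t₂ through t₁ and t₃, which leaves exactly
the multiples of w. -/
theorem exists_of_mul_w_eq_zero {t : T g 0} (ht : t * w g 0 = 0) : ∃ s, t = s * w g 0 := by
  have hc := congrArg (coord g 0 0) ht
  rw [coord_mul_w, map_zero (coord g 0 0)] at hc
  have h1 := congrFun hc 1
  have h3 := congrFun hc 3
  simp only [Matrix.cons_val, Pi.zero_apply] at h1 h3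
  refine ⟨ofCoord g 0 0 ![-coord g 0 0 t 1, 0, coord g 0 0 t 3, 0], ?_⟩
  refine ext_coord ?_ ?_ ?_ ?_ <;>
  simp only [coord_mul_w, coord_ofCoord, Matrix.cons_val, C_0]
  · linear_combination -h1
  · ring
  · linear_combination h3
  · ring

end Annihilators

/-! ### The finite resolution for h ≠ 0 -/

section Resolutions

variable {k : Type u} [Field k]

theorem exact_vecMulLinear {R : Type*} [Ring R] {l m n : ℕ} {M : Matrix (Fin l) (Fin m) R}
    {N : Matrix (Fin m) (Fin n) R} (hMN : M * N = 0)
    (hex : ∀ v, Matrix.vecMul v N = 0 → ∃ u, v = Matrix.vecMul u M) :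
    Function.Exact M.vecMulLinear N.vecMulLinear := by
  intro v
  constructor
  · intro hv
    obtain ⟨u, rfl⟩ := hex v hv
    exact ⟨u, rfl⟩
  · rintro ⟨u, rfl⟩
    rw [Matrix.vecMulLinear_apply, Matrix.vecMulLinear_apply, Matrix.vecMul_vecMul, hMN,
      Matrix.vecMul_zero]

theorem exact_of_subsingleton {R L M N : Type*} [Ring R] [AddCommGroup L] [AddCommGroup M]
    [AddCommGroup N] [Module R L] [Module R M] [Module R N] [Subsingleton M] (f : L →ₗ[R] M)
    (g : M →ₗ[R] N) : Function.Exact f g := by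
  intro m
  rw [Subsingleton.elim m 0, map_zero]
  exact ⟨fun _ => ⟨0, map_zero f⟩, fun _ => rfl⟩

variable (g h : k)

theorem isConnectedGraded_gradingT : IsConnectedGraded (gradingT g h) :=
  isConnectedGraded_wordGrading (quadraticRels_weierstrassRels g h)

theorem gradingT_eq (n : ℕ) :
    gradingT g h n = Submodule.span k (Set.range ![x g h, y g h, w g h]) ^ n := by
  have : gen (weierstrassRels g h) = ![x g h, y g h, w g h] := by
    ext i; fin_cases i <;> rfl
  rw [gradingT, wordGrading, this]

theorem x_mem : x g h ∈ intGrading (gradingT g h) 1 := gen_mem_wordGrading 0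

theorem y_mem : y g h ∈ intGrading (gradingT g h) 1 := gen_mem_wordGrading 1

theorem w_mem : w g h ∈ intGrading (gradingT g h) 1 := gen_mem_wordGrading 2

theorem exact_matrix_zero (D : Matrix (Fin 3) (Fin 1) (T g h))
    (hD : D = !![x g h; y g h; w g h]) : Function.Exact D.vecMulLinear (augmentation g h) := by
  refine exact_freeAugmentation fun n => ?_
  rw [gradingT_eq, hD]
  congr 3
  ext i
  fin_cases i <;> rfl

theorem matQ_one_mul_zero : matQ g h 1 * matQ g h 0 = 0 := by
  have h1 := y_mul_x g h
  have h2 := w_mul_y g h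
  have h3 := w_mul_w g h
  ext i j
  fin_cases i <;> fin_cases j <;>
  simp [matQ, Matrix.mul_apply, Fin.sum_univ_three, sub_mul, h1, h2, h3]

theorem matQ_two_mul_one : matQ g h 2 * matQ g h 1 = 0 := by
  have h1 := y_mul_x g h
  have h2 := w_mul_y g h
  have h3 := w_mul_w g h
  ext i j
  fin_cases i; fin_cases j <;>
  simp [matQ, Matrix.mul_apply, Fin.sum_univ_three, mul_sub, h1, h2, h3]
  module

/-- Exactness at the second term, for all `h`. -/
theorem exists_of_vecMul_matQ_zero (v : Fin 3 → T g h) (hv : Matrix.vecMul v (matQ g h 0) = 0) :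
    ∃ u : Fin 3 → T g h, v = Matrix.vecMul u (matQ g h 1) := by
  have h0 := congrFun hv 0
  simp only [matQ, Matrix.vecMul, dotProduct, Fin.sum_univ_three, Matrix.of_apply,
    Matrix.cons_val, Pi.zero_apply] at h0
  obtain ⟨s, t, hst⟩ := exists_of_mul_w_eq (a := v 2) (b := -v 0) (c := -v 1) (by
    rw [neg_mul, neg_mul, ← sub_eq_zero, ← h0]; abel)
  -- Subtracting s times the first row and t times the second row of the matrix removes the
  -- w-component. What remains is a syzygy of (x, y), a multiple of the third row.
  have h1 : (v 0 + s * x g h) * x g h +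
      (v 1 - s * (w g h - g • y g h) - t * (h • y g h)) * y g h = 0 := by
    have h2 := w_mul_y g h
    have h3 := w_mul_w g h
    have h4 : s * y g h * w g h = s * (y g h * w g h) := mul_assoc _ _ _
    have h5 : t * w g h * w g h = t * (w g h * w g h) := mul_assoc _ _ _
    rw [hst, add_mul, h4, h5, h3] at h0
    rw [← h0]
    simp only [add_mul, sub_mul, mul_sub, mul_assoc, h2, mul_add, mul_neg, mul_smul_comm,
      smul_mul_assoc]
    abel
  obtain ⟨c, hc1, hc2⟩ := exists_of_mul_x_add_mul_y_eq_zero h1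
  refine ⟨![s, t, c], ?_⟩
  ext1 j
  fin_cases j <;> simp [matQ, Matrix.vecMul, dotProduct, Fin.sum_univ_three]
  · rw [← hc1]; abel
  · rw [← hc2]; simp only [mul_smul_comm]; abel
  · exact hst

theorem resolutionQ (hh : h ≠ 0) : ResolutionQ g h := by
  have h𝒜 := isConnectedGraded_gradingT g h
  have hs : ∀ (c : k) {a : T g h} {n : ℤ}, a ∈ intGrading (gradingT g h) n →
      c • a ∈ intGrading (gradingT g h) n := fun c _ _ ha => Submodule.smul_mem _ c ha
  have hx := x_mem g h
  have hy := y_mem g h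
  have hw := w_mem g h
  refine ⟨⟨fun i => h𝒜.isGradedModule_freeGrading _, fun i n p hp => ?_, fun n p hp => ?_,
    fun i => ?_, exact_matrix_zero g h _ rfl, freeAugmentation_surjective⟩,
    fun i => h𝒜.isGradedFree_freeGrading _⟩
  · refine h𝒜.vecMul_mem_freeGrading (fun r s => ?_) hp
    have hd : degQ (i + 1) r - degQ i s = 1 := by simp [degQ]
    rw [hd]
    match i, r, s with
    | 0, r, s =>
      fin_cases r <;> fin_cases s
      exacts [hx, hy, hw]
    | 1, r, s =>
      fin_cases r <;> fin_cases s
      exacts [neg_mem hx, sub_mem hw (hs g hy), hy, zero_mem _, hs h hy, hw, neg_mem hy, hx,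
        zero_mem _]
    | 2, r, s =>
      fin_cases r; fin_cases s
      exacts [hs h hy, hw, neg_mem (hs h hx)]
    | i + 3, r, s => exact r.elim0
  · exact freeAugmentation_mem hp
  · match i with
    | 0 => exact exact_vecMulLinear (matQ_one_mul_zero g h) (exists_of_vecMul_matQ_zero g h)
    | 1 =>
      refine exact_vecMulLinear (matQ_two_mul_one g h) fun (v : Fin 3 → T g h) hv => ?_
      have h0 := congrFun hv 0
      have h2 := congrFun hv 2
      simp only [matQ, Matrix.vecMul, dotProduct, Fin.sum_univ_three, Matrix.of_apply,
        Matrix.cons_val, Pi.zero_apply, mul_zero, add_zero] at h0 h2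
      obtain ⟨c, hc1, hc2⟩ := exists_of_mul_y_add_mul_w_eq_zero hh h2
      -- The third column determines the first two entries. The first column then determines v₂ y,
      -- and y is cancelled; the middle column is not needed.
      have h3 : v 2 = -(h • (c * x g h)) := by
        rw [← sub_eq_zero]
        refine eq_zero_of_mul_y_eq_zero ?_
        rw [hc1] at h0
        have h1 := y_mul_x g h
        rw [← neg_eq_zero, ← h0]
        simp only [sub_mul, neg_mul, smul_mul_assoc, mul_neg, mul_assoc, h1]
        abel
      refine ⟨![c], ?_⟩
      ext1 j
      fin_cases j <;> simp [matQ, Matrix.vecMul, dotProduct]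
      exacts [hc1, hc2, h3]
    | 2 =>
      refine exact_vecMulLinear (Matrix.zero_mul _) fun (v : Fin 1 → T g h) hv => ⟨0, ?_⟩
      have h1 := congrFun hv 1
      simp only [matQ, Matrix.vecMul, dotProduct, Matrix.of_apply, Finset.univ_unique,
        Finset.sum_singleton, Pi.zero_apply] at h1
      rw [Matrix.zero_vecMul]
      ext1 j
      rw [Subsingleton.elim j default]
      exact eq_zero_of_mul_w_eq_zero hh h1
    | i + 3 => exact exact_of_subsingleton (M := Fin 0 → T g h) _ _

theorem isKoszul_gradingT (hh : h ≠ 0) : IsKoszul (gradingT g h) :=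
  (isConnectedGraded_gradingT g h).isKoszul_of_isGradedResolution (resolutionQ g h hh).1

end Resolutions

/-! ### The infinite resolution for h = 0 -/

section ResolutionP

variable {k : Type u} [Field k] (g : k)

theorem w_mul_w_zero : w g 0 * w g 0 = 0 := by
  rw [w_mul_w, zero_smul, neg_zero]

theorem matP_one : matP g 0 1 = matQ g 0 1 := by
  ext i j
  fin_cases i <;> fin_cases j <;> simp [matP, matQ]

theorem matP_two_mul_one : matP g 0 2 * matP g 0 1 = 0 := by
  have h1 := y_mul_x g 0
  have h2 : y g 0 * y g 0 * x g 0 = x g 0 * (y g 0 * y g 0) := by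
    rw [mul_assoc, h1, ← mul_assoc, h1, mul_assoc]
  have h3 := w_mul_w_zero g
  have h4 := (commute_w_sq_y g 0).eq
  have h5 := w_mul_y g 0
  ext i j
  fin_cases i <;> fin_cases j <;>
  simp [matP, Matrix.mul_apply, Fin.sum_univ_three, h3, pow_two]
  · rw [mul_assoc (w g 0), mul_assoc (w g 0), h1]; abel
  · rw [mul_assoc (w g 0), mul_sub, mul_assoc (w g 0) (x g 0), mul_smul_comm, mul_sub,
      mul_smul_comm, ← sub_eq_zero]
    -- Multiply the relation for wy + yw by w on the left and use w² = 0.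
    have h6 : w g 0 * (y g 0 * w g 0) = w g 0 * (x g 0 * x g 0) + g • (w g 0 * (y g 0 * y g 0)) := by
      have : y g 0 * w g 0 = -(w g 0 * y g 0) + x g 0 * x g 0 + g • (y g 0 * y g 0) := by
        rw [h5]; abel
      rw [this, mul_add, mul_add, mul_neg, ← mul_assoc, h3, mul_smul_comm]
      simp
    rw [h6]
    abel
  · rw [mul_assoc, h4]; abel

theorem matP_three_mul_two : matP g 0 3 * matP g 0 2 = 0 := by
  have h3 := w_mul_w_zero g
  have h4 := (commute_w_sq_y g 0).eq
  ext i j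
  fin_cases i <;> fin_cases j <;>
  simp [matP, Matrix.mul_apply, Fin.sum_univ_two, h3, pow_two, h4, ← mul_assoc]

theorem matP_four_mul_three (n : ℕ) : matP g 0 (n + 4) * matP g 0 3 = 0 := by
  have h3 := w_mul_w_zero g
  have h4 := (commute_w_sq_y g 0).eq
  ext i j
  fin_cases i <;> fin_cases j <;>
  simp [matP, Matrix.mul_apply, Fin.sum_univ_two, h3, pow_two, h4]

theorem matP_five_mul_four (n m : ℕ) : matP g 0 (n + 4) * matP g 0 (m + 4) = 0 := by
  have h3 := w_mul_w_zero g
  have h4 := (commute_w_sq_y g 0).eq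
  ext i j
  fin_cases i <;> fin_cases j <;>
  simp [matP, Matrix.mul_apply, Fin.sum_univ_two, h3, pow_two, h4]

/-- The hypotheses describe the kernels of both `matP g 0 3` and the later matrices, which differ
only in the sign of one w. Since y² commutes with w, v₁ = t w turns the first equation into (v₀ + t
y²) w = 0, and the annihilator of w is used again. -/
theorem exists_of_vecMul_matP_four (v : Fin 2 → T g 0)
    (h0 : v 0 * w g 0 + v 1 * y g 0 ^ 2 = 0) (h1 : v 1 * w g 0 = 0) :
    ∃ u : Fin 2 → T g 0, v = Matrix.vecMul u (matP g 0 4) := by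
  obtain ⟨t, ht⟩ := exists_of_mul_w_eq_zero h1
  obtain ⟨s, hs⟩ := exists_of_mul_w_eq_zero (t := v 0 + t * y g 0 ^ 2) (by
    rw [ht, mul_assoc t, pow_two, (commute_w_sq_y g 0).eq, ← mul_assoc] at h0
    rw [add_mul, pow_two]
    exact h0)
  refine ⟨![s, -t], ?_⟩
  ext1 j
  fin_cases j <;> simp [matP, Matrix.vecMul, dotProduct, Fin.sum_univ_two]
  · rw [← hs]; abel
  · exact ht

theorem matP_mem (i : ℕ) (r : Fin (rankP (i + 1))) (s : Fin (rankP i)) :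
    matP g 0 i r s ∈ intGrading (gradingT g 0) (degP (i + 1) r - degP i s) := by
  have h𝒜 := isConnectedGraded_gradingT g 0
  -- The degree is left as a variable because the differences of generator degrees have to be
  -- simplified before they become 1 or 2.
  have hx : ∀ n : ℤ, n = 1 → x g 0 ∈ intGrading (gradingT g 0) n := fun n hn => hn ▸ x_mem g 0
  have hy : ∀ n : ℤ, n = 1 → y g 0 ∈ intGrading (gradingT g 0) n := fun n hn => hn ▸ y_mem g 0
  have hw : ∀ n : ℤ, n = 1 → w g 0 ∈ intGrading (gradingT g 0) n := fun n hn => hn ▸ w_mem g 0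
  have hwx : ∀ n : ℤ, n = 2 → w g 0 * x g 0 ∈ intGrading (gradingT g 0) n := fun n hn =>
    hn ▸ h𝒜.mul_mem_intGrading (w_mem g 0) (x_mem g 0)
  have hwy : ∀ n : ℤ, n = 2 → w g 0 * y g 0 ∈ intGrading (gradingT g 0) n := fun n hn =>
    hn ▸ h𝒜.mul_mem_intGrading (w_mem g 0) (y_mem g 0)
  have hyy : ∀ n : ℤ, n = 2 → y g 0 ^ 2 ∈ intGrading (gradingT g 0) n := fun n hn => by
    rw [hn, pow_two]
    exact h𝒜.mul_mem_intGrading (y_mem g 0) (y_mem g 0)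
  match i, r, s with
  | 0, r, s =>
    fin_cases r <;> fin_cases s
    exacts [hx _ (by simp [degP]), hy _ (by simp [degP]), hw _ (by simp [degP])]
  | 1, r, s =>
    fin_cases r <;> fin_cases s
    exacts [neg_mem (hx _ (by simp [degP])),
      sub_mem (hw _ (by simp [degP])) (Submodule.smul_mem _ g (hy _ (by simp [degP]))),
      hy _ (by simp [degP]), zero_mem _, zero_mem _, hw _ (by simp [degP]),
      neg_mem (hy _ (by simp [degP])), hx _ (by simp [degP]), zero_mem _]
  | 2, r, s =>
    fin_cases r <;> fin_cases s
    exacts [zero_mem _, hw _ (by simp [degP]), zero_mem _, hwy _ (by simp [degP]),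
      neg_mem (hyy _ (by simp [degP])), neg_mem (hwx _ (by simp [degP]))]
  | 3, r, s =>
    fin_cases r <;> fin_cases s
    exacts [hw _ (by simp [degP]), zero_mem _, hyy _ (by simp [degP]), hw _ (by simp [degP])]
  | i + 4, r, s =>
    fin_cases r <;> fin_cases s
    exacts [hw _ (by simp [degP]), zero_mem _, hyy _ (by simp [degP]; ring),
      neg_mem (hw _ (by simp [degP]))]

theorem exact_matP_zero : Function.Exact (matP g 0 1).vecMulLinear (matP g 0 0).vecMulLinear := by
  refine exact_vecMulLinear ?_ fun v hv => ?_
  · rw [matP_one]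
    exact matQ_one_mul_zero g 0
  · rw [matP_one]
    exact exists_of_vecMul_matQ_zero g 0 v hv

theorem exact_matP_one : Function.Exact (matP g 0 2).vecMulLinear (matP g 0 1).vecMulLinear := by
  refine exact_vecMulLinear (matP_two_mul_one g) fun (v : Fin 3 → T g 0) hv => ?_
  have h0 := congrFun hv 0
  have h2 := congrFun hv 2
  simp only [matP, Matrix.vecMul, dotProduct, Fin.sum_univ_three, Matrix.of_apply,
    Matrix.cons_val, Pi.zero_apply, mul_zero, add_zero] at h0 h2
  obtain ⟨s, t, h3, h4⟩ := exists_of_mul_y_add_mul_w_eq_zero' h2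
  have h5 : v 2 = -(t * (w g 0 * x g 0)) := by
    rw [← sub_eq_zero]
    refine eq_zero_of_mul_y_eq_zero ?_
    rw [h3] at h0
    have h1 := y_mul_x g 0
    rw [← neg_eq_zero, ← h0]
    simp only [sub_mul, neg_mul, mul_neg, mul_assoc, h1]
    abel
  refine ⟨![s, t], ?_⟩
  ext1 j
  fin_cases j <;> simp [matP, Matrix.vecMul, dotProduct, Fin.sum_univ_two]
  · exact h3
  · rw [pow_two, ← sub_eq_add_neg]; exact h4
  · exact h5

theorem exact_matP_two : Function.Exact (matP g 0 3).vecMulLinear (matP g 0 2).vecMulLinear := by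
  refine exact_vecMulLinear (matP_three_mul_two g) fun (v : Fin 2 → T g 0) hv => ?_
  have h0 := congrFun hv 0
  have h1 := congrFun hv 1
  simp only [matP, Matrix.vecMul, dotProduct, Fin.sum_univ_two, Matrix.of_apply,
    Matrix.cons_val, Pi.zero_apply, mul_zero, zero_add] at h0 h1
  rw [← mul_assoc] at h0
  obtain ⟨t, ht⟩ := exists_of_mul_w_eq_zero (eq_zero_of_mul_y_eq_zero h0)
  -- Writing v₁ = t w and commuting w past y² makes the middle column a right multiple of w.
  obtain ⟨s, hs⟩ := exists_of_mul_w_eq_zero (t := v 0 - t * y g 0 ^ 2) (by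
    rw [ht, mul_neg, mul_assoc t, pow_two, (commute_w_sq_y g 0).eq, ← mul_assoc] at h1
    rw [sub_mul, pow_two, sub_eq_add_neg]
    exact h1)
  refine ⟨![s, t], ?_⟩
  ext1 j
  fin_cases j <;> simp [matP, Matrix.vecMul, dotProduct, Fin.sum_univ_two]
  · rw [← hs]; abel
  · exact ht

theorem exact_matP_three : Function.Exact (matP g 0 4).vecMulLinear (matP g 0 3).vecMulLinear := by
  refine exact_vecMulLinear (matP_four_mul_three g 0) fun (v : Fin 2 → T g 0) hv => ?_
  exact exists_of_vecMul_matP_four g v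
    (by simpa [matP, Matrix.vecMul, dotProduct, Fin.sum_univ_two] using congrFun hv 0)
    (by simpa [matP, Matrix.vecMul, dotProduct, Fin.sum_univ_two] using congrFun hv 1)

theorem exact_matP_four (i : ℕ) : Function.Exact (matP g 0 (i + 5)).vecMulLinear (matP g 0 (i + 4)).vecMulLinear := by
  refine exact_vecMulLinear (matP_five_mul_four g (i + 1) i) fun (v : Fin 2 → T g 0) hv => ?_
  exact exists_of_vecMul_matP_four g v
    (by simpa [matP, Matrix.vecMul, dotProduct, Fin.sum_univ_two] using congrFun hv 0)
    (by simpa [matP, Matrix.vecMul, dotProduct, Fin.sum_univ_two] using congrFun hv 1)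

theorem resolutionP : ResolutionP g 0 := by
  have h𝒜 := isConnectedGraded_gradingT g 0
  refine ⟨⟨fun i => h𝒜.isGradedModule_freeGrading _, fun i n p hp => ?_, fun n p hp => ?_,
    fun i => ?_, exact_matrix_zero g 0 _ rfl, freeAugmentation_surjective⟩,
    fun i => h𝒜.isGradedFree_freeGrading _⟩
  · refine h𝒜.vecMul_mem_freeGrading (fun r s => ?_) hp
    exact matP_mem g i r s
  · exact freeAugmentation_mem hp
  · match i with
    | 0 => exact exact_matP_zero g
    | 1 => exact exact_matP_one g
    | 2 => exact exact_matP_two g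
    | 3 => exact exact_matP_three g
    | i + 4 => exact exact_matP_four g i

end ResolutionP

/-! ### Comparison maps between resolutions -/

section Lifting

variable {k : Type u} [Field k] {A : Type v} [Ring A] [Algebra k A] {𝒜 : ℕ → Submodule k A}

/-- A homogeneous element in the image of a graded homomorphism has a homogeneous preimage. -/
theorem IsGradedModule.exists_homogeneous_preimage {M N : Type*} [AddCommGroup M] [Module A M]
    [AddCommGroup N] [Module A N] {ℳ : ℤ → AddSubgroup M} {𝒩 : ℤ → AddSubgroup N}
    (hM : IsGradedModule 𝒜 ℳ) (f : M →ₗ[A] N) (hf : ∀ n m, m ∈ ℳ n → f m ∈ 𝒩 n) {n : ℤ}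
    (π : N →+ N) (hπ : ∀ i, ∀ b ∈ 𝒩 i, π b = if i = n then b else 0) {m : M} (hm : f m ∈ 𝒩 n) :
    ∃ m' ∈ ℳ n, f m' = f m := by
  obtain ⟨pr, h1, h2, h3⟩ := exists_proj hM.isInternal
  have key : f (pr n m) = π (f m) := by
    have := h3 m
    clear hm
    induction this using AddSubmonoid.closure_induction with
    | mem m hm =>
      obtain ⟨i, hi⟩ := Set.mem_iUnion.1 hm
      rw [h2 i n m hi, hπ i _ (hf i m hi)]
      split_ifs <;> simp
    | zero => simp
    | add a b _ _ ha hb => rw [map_add, map_add, map_add, map_add, ha, hb]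
  exact ⟨pr n m, h1 n m, by rw [key, hπ n _ hm, if_pos rfl]⟩

/-- Homogeneous preimages of the basis vectors define the lift. The target is only assumed to have
degree projections, so that the trivial module is covered as well as the terms of a resolution. -/
theorem exists_graded_lift {M N : Type*} [AddCommGroup M] [Module A M]
    [AddCommGroup N] [Module A N] {ℳ : ℤ → AddSubgroup M} {𝒩 : ℤ → AddSubgroup N}
    (h𝒜 : IsConnectedGraded 𝒜) (hM : IsGradedModule 𝒜 ℳ)
    (hN : ∀ n, ∃ π : N →+ N, ∀ i, ∀ b ∈ 𝒩 i, π b = if i = n then b else 0)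
    (f : M →ₗ[A] N) (hf : ∀ n m, m ∈ ℳ n → f m ∈ 𝒩 n)
    {r : ℕ} {deg : Fin r → ℤ} (ψ : (Fin r → A) →ₗ[A] N)
    (hψ : ∀ n v, v ∈ freeGrading 𝒜 deg n → ψ v ∈ 𝒩 n) (hr : ∀ v, ∃ m, f m = ψ v) :
    ∃ φ : (Fin r → A) →ₗ[A] M, (∀ n v, v ∈ freeGrading 𝒜 deg n → φ v ∈ ℳ n) ∧
      ∀ v, f (φ v) = ψ v := by
  have hp : ∀ j : Fin r, ∃ p ∈ ℳ (deg j), f p = ψ (Pi.single j 1) := by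
    intro j
    obtain ⟨m, hm⟩ := hr (Pi.single j 1)
    obtain ⟨π, hπ⟩ := hN (deg j)
    rw [← hm]
    refine hM.exists_homogeneous_preimage f hf π hπ ?_
    rw [hm]
    refine hψ _ _ (single_mem_freeGrading ?_)
    simpa [intGrading_zero] using h𝒜.one_mem
  choose p hp1 hp2 using hp
  refine ⟨Fintype.linearCombination A p, fun n v hv => ?_, fun v => ?_⟩
  · rw [Fintype.linearCombination_apply]
    refine sum_mem fun j _ => ?_
    have hj := mem_freeGrading.1 hv j
    rcases hn : n - deg j with i | i
    · rw [hn] at hj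
      have := hM.smul_mem i (deg j) (v j) (p j) hj (hp1 j)
      rwa [show (i : ℤ) + deg j = n by rw [← sub_add_cancel n (deg j), hn]; rfl] at this
    · rw [hn] at hj
      rw [(Submodule.mem_bot k).1 hj, zero_smul]
      exact zero_mem _
  · rw [Fintype.linearCombination_apply, map_sum]
    conv_rhs => rw [← Finset.univ_sum_single v, map_sum]
    refine Finset.sum_congr rfl fun j _ => ?_
    rw [map_smul, hp2, ← map_smul, ← Pi.single_smul, smul_eq_mul, mul_one]

theorem exists_projective_lift {P M N : Type*} [AddCommGroup P] [Module A P] [AddCommGroup M]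
    [Module A M] [AddCommGroup N] [Module A N] [Module.Projective A P] (f : M →ₗ[A] N)
    (χ : P →ₗ[A] N) (hχ : ∀ p, ∃ m, f m = χ p) : ∃ ψ : P →ₗ[A] M, ∀ p, f (ψ p) = χ p := by
  obtain ⟨ψ, hψ⟩ := Module.projective_lifting_property f.rangeRestrict
    (χ.codRestrict (LinearMap.range f) hχ) f.surjective_rangeRestrict
  refine ⟨ψ, fun p => ?_⟩
  exact congrArg Subtype.val (LinearMap.congr_fun hψ p)

theorem IsGradedModule.exists_proj {M : Type*} [AddCommGroup M] [Module A M]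
    {ℳ : ℤ → AddSubgroup M} (hM : IsGradedModule 𝒜 ℳ) (n : ℤ) :
    ∃ π : M →+ M, ∀ i, ∀ b ∈ ℳ i, π b = if i = n then b else 0 := by
  obtain ⟨pr, -, h2, -⟩ := KoszulTTP.exists_proj hM.isInternal
  exact ⟨pr n, fun i b hb => h2 i n b hb⟩

theorem trivialGrading_eq_zero {n : ℤ} (hn : n ≠ 0) {q : TrivialModule 𝒜}
    (hq : q ∈ trivialGrading 𝒜 n) : q = 0 := by
  obtain ⟨a, ha, rfl⟩ := hq
  refine (Submodule.Quotient.mk_eq_zero (augIdeal 𝒜)).2 ?_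
  rcases n with n | n
  · have h0 : 0 < n := Nat.pos_of_ne_zero fun h => hn (by simp [h])
    exact Submodule.subset_span ⟨n, h0, ha⟩
  · rw [(Submodule.mem_bot k).1 ha]
    exact zero_mem _

/-- The trivial module is concentrated in degree 0, so the projections are the identity and zero. -/
theorem trivialGrading_exists_proj (n : ℤ) : ∃ π : TrivialModule 𝒜 →+ TrivialModule 𝒜,
    ∀ i, ∀ b ∈ trivialGrading 𝒜 i, π b = if i = n then b else 0 := by
  by_cases hn : n = 0
  · refine ⟨AddMonoidHom.id _, fun i b hb => ?_⟩
    by_cases hi : i = n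
    · simp [hi]
    · rw [trivialGrading_eq_zero (fun h => hi (h.trans hn.symm)) hb]; simp
  · refine ⟨0, fun i b hb => ?_⟩
    by_cases hi : i = n
    · subst hi
      rw [trivialGrading_eq_zero hn hb]; simp
    · simp [hi]

/-- If `M` is generated in degree `d`, then a function on `M` which factors through `k ⊗ M`
vanishes on all elements of a degree different from `d`. -/
theorem IsGradedModule.eq_zero_of_isGeneratedInDegree {M : Type*} [AddCommGroup M] [Module A M]
    {ℳ : ℤ → AddSubgroup M} (h𝒜 : IsConnectedGraded 𝒜) (hM : IsGradedModule 𝒜 ℳ) {d : ℤ}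
    (hgen : IsGeneratedInDegree A ℳ d) (α : A →+* k) (hα : ∀ n, 0 < n → ∀ a ∈ 𝒜 n, α a = 0)
    (F : M →+ k) (hF : ∀ (a : A) (m : M), F (a • m) = α a * F m) {n : ℤ} (hn : n ≠ d) {m : M}
    (hm : m ∈ ℳ n) : F m = 0 := by
  obtain ⟨pr, -, h2, h3⟩ := KoszulTTP.exists_proj hM.isInternal
  obtain ⟨prA, -, -, h4⟩ := KoszulTTP.exists_proj h𝒜.isInternal
  have hsmul : ∀ (i : ℕ) (a : A), a ∈ 𝒜 i → ∀ (n : ℤ) (m : M),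
      pr n (a • m) = a • pr (n - i) m := by
    intro i a ha n m
    have := h3 m
    induction this using AddSubmonoid.closure_induction with
    | mem m hm =>
      obtain ⟨j, hj⟩ := Set.mem_iUnion.1 hm
      rw [h2 _ n _ (hM.smul_mem i j a m ha hj), h2 j _ m hj]
      by_cases h : (i : ℤ) + j = n
      · rw [if_pos h, if_pos (by omega)]
      · rw [if_neg h, if_neg (by omega), smul_zero]
    | zero => simp
    | add m m' _ _ hm hm' => rw [smul_add, map_add, map_add, smul_add, hm, hm']
  -- Scalars of degree 0 do not shift components, and those of positive degree are killed by `α`.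
  -- Hence this set is a submodule; it contains the generators in degree d.
  let N : Submodule A M :=
    { carrier := {m | ∀ n, n ≠ d → F (pr n m) = 0}
      add_mem' := fun ha hb n hn => by rw [map_add, map_add, ha n hn, hb n hn, add_zero]
      zero_mem' := fun n _ => by rw [map_zero, map_zero]
      smul_mem' := fun a m hm n hn => by
        have := h4 a
        induction this using AddSubmonoid.closure_induction with
        | mem a ha =>
          obtain ⟨i, hi⟩ := Set.mem_iUnion.1 ha
          rw [hsmul i a hi, hF]
          rcases Nat.eq_zero_or_pos i with rfl | h0
          · rw [Nat.cast_zero, sub_zero, hm n hn, mul_zero]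
          · rw [hα i h0 a hi, zero_mul]
        | zero => simp
        | add a b _ _ ha hb => rw [add_smul, map_add, map_add, ha, hb, add_zero] }
  have hN : N = ⊤ := by
    rw [eq_top_iff, ← show Submodule.span A (ℳ d : Set M) = ⊤ from hgen, Submodule.span_le]
    intro m hm n hn
    rw [h2 d n m hm, if_neg hn.symm, map_zero]
  have hmN : m ∈ N := by rw [hN]; trivial
  have := hmN n hn
  rwa [h2 n n m hm, if_pos rfl] at this

end Lifting

/-! ### The failure of the Koszul property for h = 0 -/

section NotKoszul

variable {k : Type u} [Field k]

theorem aug_eq_zero {rels : Set (FreeAlgebra k (Fin 3))} (hrels : QuadraticRels rels) (n : ℕ)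
    (hn : 0 < n) (a : Presented rels) (ha : a ∈ wordGrading rels n) : aug hrels a = 0 := by
  obtain ⟨n, rfl⟩ := Nat.exists_eq_succ_of_ne_zero hn.ne'
  rw [wordGrading, pow_succ] at ha
  refine Submodule.mul_induction_on ha (fun b _ c hc => ?_) fun b c hb hc => ?_
  · have : aug hrels c = 0 := by
      induction hc using Submodule.span_induction with
      | mem c h => obtain ⟨i, rfl⟩ := h; exact aug_gen hrels i
      | zero => simp
      | add b c _ _ hb hc => rw [map_add, hb, hc, add_zero]
      | smul r c _ hc => rw [map_smul, hc, smul_zero]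
    rw [map_mul, this, mul_zero]
  · rw [map_add, hb, hc, add_zero]

/-- Over a graded algebra with augmentation, a minimal graded free resolution whose third term has
a generator of degree different from 3 obstructs the Koszul property. -/
theorem not_isKoszul_of_isGradedResolution {A : Type u} [Ring A] [Algebra k A]
    {𝒜 : ℕ → Submodule k A} (h𝒜 : IsConnectedGraded 𝒜) (α : A →+* k)
    (hα : ∀ n, 0 < n → ∀ a ∈ 𝒜 n, α a = 0) {rank : ℕ → ℕ} {deg : ∀ i, Fin (rank i) → ℤ}
    {D : ∀ i, Matrix (Fin (rank (i + 1))) (Fin (rank i)) A}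
    {ε' : (Fin (rank 0) → A) →ₗ[A] TrivialModule 𝒜}
    (hF : IsGradedResolution 𝒜 (P := fun i => Fin (rank i) → A)
      (fun i => freeGrading 𝒜 (deg i)) (fun i => (D i).vecMulLinear) ε')
    (hmin : ∀ i r s, α (D i r s) = 0) (j : Fin (rank 3)) (hj : deg 3 j ≠ 3) : ¬ IsKoszul 𝒜 := by
  rintro ⟨P, _, _, 𝒢, d, ε, hP, hproj, hgen⟩
  have hF0 : ∀ i u, (D i).vecMulLinear ((D (i + 1)).vecMulLinear u) = 0 :=
    fun i u => (hF.exact_succ i _).2 ⟨u, rfl⟩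
  have hP0 : ∀ i p, d i (d (i + 1) p) = 0 := fun i p => (hP.exact_succ i _).2 ⟨p, rfl⟩
  -- The maps φ from the free resolution to P must preserve degrees, since the contradiction comes
  -- from the degree of one generator.
  have hstep : ∀ i (φ : (Fin (rank i) → A) →ₗ[A] P i)
      (_ : ∀ n v, v ∈ freeGrading 𝒜 (deg i) n → φ v ∈ 𝒢 i n)
      (_ : ∀ v, ∃ p, d i p = φ ((D i).vecMulLinear v)),
      ∃ φ' : (Fin (rank (i + 1)) → A) →ₗ[A] P (i + 1),
        (∀ n v, v ∈ freeGrading 𝒜 (deg (i + 1)) n → φ' v ∈ 𝒢 (i + 1) n) ∧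
        ∀ v, d i (φ' v) = φ ((D i).vecMulLinear v) := fun i φ hφ hr =>
    exists_graded_lift h𝒜 (hP.graded (i + 1)) (hP.graded i).exists_proj (d i) (hP.d_mem i)
      (φ ∘ₗ (D i).vecMulLinear) (fun n v hv => hφ n _ (hF.d_mem i n v hv)) hr
  obtain ⟨φ₀, hφ₀, hε₀⟩ := exists_graded_lift h𝒜 (hP.graded 0) trivialGrading_exists_proj ε hP.ε_mem
    ε' hF.ε_mem fun v => hP.surjective _
  obtain ⟨φ₁, hφ₁, hd₁⟩ := hstep 0 φ₀ hφ₀ fun v => (hP.exact_zero _).1 <| by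
    rw [hε₀]; exact (hF.exact_zero _).2 ⟨v, rfl⟩
  obtain ⟨φ₂, hφ₂, hd₂⟩ := hstep 1 φ₁ hφ₁ fun v => (hP.exact_succ 0 _).1 <| by
    rw [hd₁, hF0, map_zero]
  obtain ⟨φ₃, hφ₃, hd₃⟩ := hstep 2 φ₂ hφ₂ fun v => (hP.exact_succ 1 _).1 <| by
    rw [hd₂, hF0, map_zero]
  -- The maps ψ back need not respect degrees; projectivity of the terms of P suffices.
  obtain ⟨ψ₀, hψ₀⟩ := exists_projective_lift ε' ε fun p => hF.surjective _
  obtain ⟨ψ₁, hψ₁⟩ := exists_projective_lift (D 0).vecMulLinear (ψ₀ ∘ₗ d 0) fun p =>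
    (hF.exact_zero _).1 <| by
      rw [LinearMap.comp_apply, hψ₀]; exact (hP.exact_zero _).2 ⟨p, rfl⟩
  obtain ⟨ψ₂, hψ₂⟩ := exists_projective_lift (D 1).vecMulLinear (ψ₁ ∘ₗ d 1) fun p =>
    (hF.exact_succ 0 _).1 <| by
      rw [LinearMap.comp_apply, hψ₁, LinearMap.comp_apply, hP0, map_zero]
  obtain ⟨ψ₃, hψ₃⟩ := exists_projective_lift (D 2).vecMulLinear (ψ₂ ∘ₗ d 2) fun p =>
    (hF.exact_succ 1 _).1 <| by
      rw [LinearMap.comp_apply, hψ₂, LinearMap.comp_apply, hP0, map_zero]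
  -- The maps s form a homotopy from ψφ to the identity. In degree 3 it is needed only at one basis
  -- vector, where `u` replaces the next map.
  obtain ⟨s₀, hs₀⟩ := exists_projective_lift (D 0).vecMulLinear (ψ₀ ∘ₗ φ₀ - LinearMap.id)
    fun v => (hF.exact_zero _).1 <| by
      rw [LinearMap.sub_apply, map_sub, LinearMap.comp_apply, hψ₀, hε₀, LinearMap.id_apply, sub_self]
  obtain ⟨s₁, hs₁⟩ := exists_projective_lift (D 1).vecMulLinear
    (ψ₁ ∘ₗ φ₁ - LinearMap.id - s₀ ∘ₗ (D 0).vecMulLinear) fun v => (hF.exact_succ 0 _).1 <| by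
      simp only [LinearMap.sub_apply, map_sub, LinearMap.comp_apply, LinearMap.id_apply, hψ₁, hd₁,
        hs₀]
      abel
  obtain ⟨s₂, hs₂⟩ := exists_projective_lift (D 2).vecMulLinear
    (ψ₂ ∘ₗ φ₂ - LinearMap.id - s₁ ∘ₗ (D 1).vecMulLinear) fun v => (hF.exact_succ 1 _).1 <| by
      simp only [LinearMap.sub_apply, map_sub, LinearMap.comp_apply, LinearMap.id_apply, hψ₂, hd₂,
        hs₁, hF0, map_zero]
      abel
  let e : Fin (rank 3) → A := Pi.single j 1
  obtain ⟨u, hu⟩ := (hF.exact_succ 2 (ψ₃ (φ₃ e) - e - s₂ ((D 2).vecMulLinear e))).1 <| by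
    simp only [LinearMap.sub_apply, map_sub, LinearMap.comp_apply, LinearMap.id_apply, hψ₃, hd₃,
      hs₂, hF0, map_zero]
    abel
  have hαD : ∀ i (v : Fin (rank (i + 1)) → A) (l : Fin (rank i)),
      α ((D i).vecMulLinear v l) = 0 := by
    intro i v l
    simp [Matrix.vecMul, dotProduct, hmin]
  -- The element φ₃ e has the degree of the exceptional generator, different from 3, while P₃ is
  -- generated in degree 3.
  have h1 : α (ψ₃ (φ₃ e) j) = 0 := by
    have he : e ∈ freeGrading 𝒜 (deg 3) (deg 3 j) :=
      single_mem_freeGrading (by simpa [intGrading_zero] using h𝒜.one_mem)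
    let F : P 3 →+ k :=
      { toFun := fun p => α (ψ₃ p j)
        map_zero' := by simp
        map_add' := by simp }
    exact (hP.graded 3).eq_zero_of_isGeneratedInDegree h𝒜 (hgen 3) α hα F
      (fun a p => by simp [F]) (by exact_mod_cast hj) (hφ₃ _ _ he)
  -- By minimality the boundary of e has coefficients killed by `α`, and s₂ is linear.
  have h2 : α (s₂ ((D 2).vecMulLinear e) j) = 0 := by
    generalize hv : (D 2).vecMulLinear e = v
    have hαv : ∀ l, α (v l) = 0 := fun l => by rw [← hv]; exact hαD 2 e l
    rw [← Finset.univ_sum_single v, map_sum, Finset.sum_apply, map_sum]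
    refine Finset.sum_eq_zero fun l _ => ?_
    have : (Pi.single l (v l) : Fin (rank 2) → A) = v l • Pi.single l 1 := by
      rw [← Pi.single_smul, smul_eq_mul, mul_one]
    rw [this, map_smul, Pi.smul_apply, smul_eq_mul, map_mul, hαv, zero_mul]
  have h3 : α (e j) = 1 := by simp [e]
  have h4 := congrArg (fun v => α (v j)) hu
  simp only [Pi.sub_apply, map_sub, h1, h2, h3] at h4
  rw [hαD] at h4
  simp at h4

theorem not_isKoszul_gradingT_zero (g : k) : ¬ IsKoszul (gradingT g 0) := by
  let α := aug (quadraticRels_weierstrassRels g 0)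
  have hx : α (x g 0) = 0 := aug_gen _ _
  have hy : α (y g 0) = 0 := aug_gen _ _
  have hw : α (w g 0) = 0 := aug_gen _ _
  -- The second generator of the third term has degree 4.
  refine not_isKoszul_of_isGradedResolution (isConnectedGraded_gradingT g 0) (α : T g 0 →+* k)
    (aug_eq_zero _) (resolutionP g).1 (fun i r s => ?_) (1 : Fin 2) (by simp [degP])
  match i, r, s with
  | 0, r, s => fin_cases r <;> fin_cases s <;> simp [matP, hx, hy, hw]
  | 1, r, s => fin_cases r <;> fin_cases s <;> simp [matP, hx, hy, hw]
  | 2, r, s => fin_cases r <;> fin_cases s <;> simp [matP, hx, hy, hw]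
  | 3, r, s => fin_cases r <;> fin_cases s <;> simp [matP, hy, hw]
  | i + 4, r, s => fin_cases r <;> fin_cases s <;> simp [matP, hy, hw]

theorem isKoszul_gradingT_iff (g h : k) : IsKoszul (gradingT g h) ↔ h ≠ 0 := by
  refine ⟨?_, isKoszul_gradingT g h⟩
  rintro hK rfl
  exact not_isKoszul_gradingT_zero g hK

end NotKoszul

/-! ### Koszulness of k[z] and k[x, y] -/

section Polynomials

open MvPolynomial

variable {k : Type u} [Field k]

theorem isConnectedGraded_homogeneousSubmodule (σ : Type*) [Finite σ] :
    IsConnectedGraded (homogeneousSubmodule σ k) where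
  nontrivial := inferInstance
  gradedMonoid := inferInstance
  isInternal :=
    letI := MvPolynomial.decomposition (σ := σ) (R := k)
    DirectSum.Decomposition.isInternal _
  connected := homogeneousSubmodule_zero σ
  finitelyGenerated := by
    classical
    have := Fintype.ofFinite σ
    refine ⟨Finset.univ.image X, fun a ha => ?_, ?_⟩
    · obtain ⟨i, -, rfl⟩ := Finset.mem_image.1 ha
      exact ⟨1, isHomogeneous_X k i⟩
    · rw [Finset.coe_image, Finset.coe_univ, Set.image_univ, adjoin_range_X]

theorem homogeneousSubmodule_eq_span_pow (σ : Type*) (n : ℕ) :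
    homogeneousSubmodule σ k n = Submodule.span k (Set.range X) ^ n := by
  rw [← homogeneousSubmodule_one_eq_span_X, homogeneousSubmodule_one_pow]

/-- The ranks of the Koszul complex of `k[z]`. -/
abbrev rankOne : ℕ → ℕ
  | 0 => 1
  | 1 => 1
  | _ + 2 => 0

/-- The differentials of the Koszul complex of `k[z]`. -/
def matOne (k : Type u) [Field k] :
    (i : ℕ) → Matrix (Fin (rankOne (i + 1))) (Fin (rankOne i)) (MvPolynomial (Fin 1) k)
  | 0 => !![X 0]
  | _ + 1 => 0

/-- The ranks of the Koszul complex of `k[x, y]`. -/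
abbrev rankTwo : ℕ → ℕ
  | 0 => 1
  | 1 => 2
  | 2 => 1
  | _ + 3 => 0

/-- The differentials of the Koszul complex of `k[x, y]`. -/
def matTwo (k : Type u) [Field k] :
    (i : ℕ) → Matrix (Fin (rankTwo (i + 1))) (Fin (rankTwo i)) (MvPolynomial (Fin 2) k)
  | 0 => !![X 0; X 1]
  | 1 => !![X 1, -X 0]
  | _ + 2 => 0

theorem X_mem_intGrading {σ : Type*} (i : σ) (n : ℕ) : (X i : MvPolynomial σ k) ∈
    intGrading (homogeneousSubmodule σ k) (((n + 1 : ℕ) : ℤ) - (n : ℤ)) := by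
  have : ((n + 1 : ℕ) : ℤ) - (n : ℤ) = 1 := by push_cast; ring
  rw [this]
  exact isHomogeneous_X k i

theorem isKoszul_homogeneousSubmodule_fin_one : IsKoszul (homogeneousSubmodule (Fin 1) k) := by
  have h𝒜 := isConnectedGraded_homogeneousSubmodule (k := k) (Fin 1)
  refine h𝒜.isKoszul_of_isGradedResolution (rank := rankOne)
    (d := fun i => (matOne k i).vecMulLinear) (ε := freeAugmentation _)
    ⟨fun i => h𝒜.isGradedModule_freeGrading _, fun i n p hp => ?_,
      fun n p hp => freeAugmentation_mem hp, fun i => ?_,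
      exact_freeAugmentation fun n => ?_, freeAugmentation_surjective⟩
  · refine h𝒜.vecMul_mem_freeGrading (fun r s => ?_) hp
    match i, r, s with
    | 0, r, s =>
      fin_cases r; fin_cases s
      exact X_mem_intGrading 0 0
    | i + 1, r, s => exact r.elim0
  · match i with
    | 0 =>
      refine exact_vecMulLinear (Matrix.zero_mul _)
        fun (v : Fin 1 → MvPolynomial (Fin 1) k) hv => ⟨0, ?_⟩
      have h0 := congrFun hv 0
      simp [matOne, Matrix.vecMul, dotProduct, X_ne_zero] at h0
      rw [Matrix.zero_vecMul]
      ext1 j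
      rw [Subsingleton.elim j 0]
      exact h0
    | i + 1 => exact exact_of_subsingleton (M := Fin 0 → MvPolynomial (Fin 1) k) _ _
  · rw [homogeneousSubmodule_eq_span_pow]
    congr 3
    ext1 i
    fin_cases i
    rfl

/-- The Koszul complex is exact because the two variables form a regular sequence. -/
theorem isKoszul_homogeneousSubmodule_fin_two : IsKoszul (homogeneousSubmodule (Fin 2) k) := by
  have h𝒜 := isConnectedGraded_homogeneousSubmodule (k := k) (Fin 2)
  refine h𝒜.isKoszul_of_isGradedResolution (rank := rankTwo)
    (d := fun i => (matTwo k i).vecMulLinear) (ε := freeAugmentation _)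
    ⟨fun i => h𝒜.isGradedModule_freeGrading _, fun i n p hp => ?_,
      fun n p hp => freeAugmentation_mem hp, fun i => ?_,
      exact_freeAugmentation fun n => ?_, freeAugmentation_surjective⟩
  · refine h𝒜.vecMul_mem_freeGrading (fun r s => ?_) hp
    match i, r, s with
    | 0, r, s =>
      fin_cases r <;> fin_cases s
      exacts [X_mem_intGrading 0 0, X_mem_intGrading 1 0]
    | 1, r, s =>
      fin_cases r; fin_cases s
      exacts [X_mem_intGrading 1 1, neg_mem (X_mem_intGrading 0 1)]
    | i + 2, r, s => exact r.elim0
  · match i with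
    | 0 =>
      refine exact_vecMulLinear ?_ fun (v : Fin 2 → MvPolynomial (Fin 2) k) hv => ?_
      · ext1 i j
        fin_cases i; fin_cases j
        simp [matTwo, Matrix.mul_apply, Fin.sum_univ_two]
        ring
      · have h0 := congrFun hv 0
        simp only [matTwo, Matrix.vecMul, dotProduct, Fin.sum_univ_two, Matrix.of_apply,
          Matrix.cons_val, Pi.zero_apply] at h0
        obtain ⟨e, h1, h2⟩ := exists_of_X_mul_add_X_mul_eq_zero (i := (0 : Fin 2)) (j := 1)
          (by decide) (u := v 0) (v := v 1) (by linear_combination h0)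
        refine ⟨![e], ?_⟩
        ext1 j
        fin_cases j <;> simp [matTwo, Matrix.vecMul, dotProduct]
        · rw [h1]; ring
        · rw [h2]; ring
    | 1 =>
      refine exact_vecMulLinear (Matrix.zero_mul _)
        fun (v : Fin 1 → MvPolynomial (Fin 2) k) hv => ⟨0, ?_⟩
      have h0 := congrFun hv 0
      simp [matTwo, Matrix.vecMul, dotProduct, X_ne_zero] at h0
      rw [Matrix.zero_vecMul]
      ext1 j
      rw [Subsingleton.elim j 0]
      exact h0
    | i + 2 => exact exact_of_subsingleton (M := Fin 0 → MvPolynomial (Fin 2) k) _ _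
  · rw [homogeneousSubmodule_eq_span_pow]
    congr 3
    ext1 i
    fin_cases i <;> rfl

end Polynomials

/-! ### The anti-automorphism of T -/

section Reversal

variable {k : Type u} [Field k] (g h : k)

/-- The anti-automorphism of `T` fixing the generators, as a homomorphism to the opposite. -/
def toOpposite : T g h →ₐ[k] (T g h)ᵐᵒᵖ :=
  Presented.lift ![.op (x g h), .op (y g h), .op (w g h)] <| by
    have h1 := y_mul_x g h
    have h2 := w_mul_y g h
    have h3 := w_mul_w g h
    rintro r (rfl | rfl | rfl) <;>
    simp only [map_sub, map_add, map_smul, map_mul, FreeAlgebra.lift_ι_apply, pow_two,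
      Matrix.cons_val, ← MulOpposite.op_mul, ← MulOpposite.op_add, ← MulOpposite.op_sub,
      ← MulOpposite.op_smul, MulOpposite.op_eq_zero_iff, h1, h2, h3]
    · abel
    · abel
    · abel

/-- The anti-automorphism of `T` fixing the generators. -/
def reverse (t : T g h) : T g h := (toOpposite g h t).unop

variable {g h}

theorem reverse_mul (s t : T g h) : reverse g h (s * t) = reverse g h t * reverse g h s := by
  rw [reverse, map_mul, MulOpposite.unop_mul]; rfl

theorem reverse_add (s t : T g h) : reverse g h (s + t) = reverse g h s + reverse g h t := by
  rw [reverse, map_add, MulOpposite.unop_add]; rfl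

theorem reverse_smul (c : k) (t : T g h) : reverse g h (c • t) = c • reverse g h t := by
  rw [reverse, map_smul, MulOpposite.unop_smul]; rfl

theorem reverse_algebraMap (c : k) : reverse g h (algebraMap k _ c) = algebraMap k _ c := by
  rw [reverse, AlgHom.commutes]; rfl

theorem reverse_gen (i : Fin 3) :
    reverse g h (gen (weierstrassRels g h) i) = gen (weierstrassRels g h) i := by
  rw [reverse, toOpposite, Presented.lift_gen]
  fin_cases i <;> rfl

theorem reverse_involutive : Function.Involutive (reverse g h) := by
  intro t
  induction t using Presented.induction with
  | algebraMap c => rw [reverse_algebraMap, reverse_algebraMap]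
  | gen i => rw [reverse_gen, reverse_gen]
  | add a b ha hb => rw [reverse_add, reverse_add, ha, hb]
  | mul a b ha hb => rw [reverse_mul, reverse_mul, ha, hb]

end Reversal

/-! ### The twisted tensor product decomposition of E -/

section TwistedTensorProduct

open MvPolynomial

variable {k : Type u} [Field k]

theorem commute_x_sq {g h : k} (t : T g h) : Commute t (x g h * x g h) := by
  induction t using Presented.induction with
  | algebraMap c => exact Algebra.commutes c _
  | gen i =>
    fin_cases i
    exacts [(Commute.refl _).mul_right (Commute.refl _), commute_y_sq_x g h, commute_w_sq_x g h]
  | add a b ha hb => exact ha.add_left hb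
  | mul a b ha hb => exact ha.mul_left hb

theorem commute_y_sq {g h : k} (t : T g h) : Commute t (y g h * y g h) := by
  have hxy : Commute (x g h) (y g h) := (y_mul_x g h).symm
  induction t using Presented.induction with
  | algebraMap c => exact Algebra.commutes c _
  | gen i =>
    fin_cases i
    exacts [hxy.mul_right hxy, (Commute.refl _).mul_right (Commute.refl _), commute_w_sq_y g h]
  | add a b ha hb => exact ha.add_left hb
  | mul a b ha hb => exact ha.mul_left hb

/-- The homomorphism `X ↦ (x - l y)² ⊗ 1`, `Y ↦ y² ⊗ 1`, `Z ↦ 1 ⊗ z`. -/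
def polyToTensor (l : k) :
    MvPolynomial (Fin 3) k →ₐ[k] MvPolynomial (Fin 2) k ⊗[k] MvPolynomial (Fin 1) k :=
  aeval ![((X 0 - l • X 1) * (X 0 - l • X 1)) ⊗ₜ 1, (X 1 * X 1) ⊗ₜ 1, 1 ⊗ₜ X 0]

/-- The map from the free module with basis `1, x, y, xy` over `k[x², y², z]` to
`k[x, y] ⊗ k[z]`. -/
def coordToTensor (l : k) : (Fin 4 → MvPolynomial (Fin 3) k) →ₗ[k]
    MvPolynomial (Fin 2) k ⊗[k] MvPolynomial (Fin 1) k where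
  toFun v := polyToTensor l (v 0) * 1 ⊗ₜ 1 + polyToTensor l (v 1) * (X 0 - l • X 1) ⊗ₜ 1 +
    polyToTensor l (v 2) * X 1 ⊗ₜ 1 + polyToTensor l (v 3) * ((X 0 - l • X 1) * X 1) ⊗ₜ 1
  map_add' v v' := by simp only [Pi.add_apply, map_add, add_mul]; abel
  map_smul' c v := by
    simp only [Pi.smul_apply, map_smul, smul_mul_assoc, RingHom.id_apply, smul_add]

/-- The range contains 1 and is stable under multiplication by algebra generators of the tensor
product. Injectivity is not needed separately; it follows from the comparison with `ofCoord`. -/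
theorem coordToTensor_surjective (l : k) : Function.Surjective (coordToTensor l) := by
  set N := LinearMap.range (coordToTensor l) with hN
  have hX : ∀ q ∈ N, q * ((X 0 - l • X 1) ⊗ₜ 1) ∈ N := by
    rintro _ ⟨v, rfl⟩
    refine ⟨Matrix.vecMul v (modelX k), ?_⟩
    have h1 : (((X 0 - l • X 1) * X 1) ⊗ₜ 1 :
        MvPolynomial (Fin 2) k ⊗[k] MvPolynomial (Fin 1) k) =
        (X 0 - l • X 1) ⊗ₜ 1 * X 1 ⊗ₜ 1 := by simp
    have h2 : polyToTensor l (X 0) = (X 0 - l • X 1) ⊗ₜ 1 * (X 0 - l • X 1) ⊗ₜ 1 := by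
      simp [polyToTensor]
    simp only [coordToTensor, LinearMap.coe_mk, AddHom.coe_mk, h1]
    simp only [Matrix.vecMul, dotProduct, Fin.sum_univ_four, modelX, Matrix.of_apply,
      Matrix.cons_val, mul_zero, add_zero, zero_add, mul_one, map_mul, h2,
      ← Algebra.TensorProduct.one_def]
    ring
  have hY : ∀ q ∈ N, q * (X 1 ⊗ₜ 1) ∈ N := by
    rintro _ ⟨v, rfl⟩
    refine ⟨Matrix.vecMul v (modelY k), ?_⟩
    have h1 : (((X 0 - l • X 1) * X 1) ⊗ₜ 1 :
        MvPolynomial (Fin 2) k ⊗[k] MvPolynomial (Fin 1) k) =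
        (X 0 - l • X 1) ⊗ₜ 1 * X 1 ⊗ₜ 1 := by simp
    have h2 : polyToTensor l (X 1) = X 1 ⊗ₜ 1 * X 1 ⊗ₜ 1 := by
      simp [polyToTensor]
    simp only [coordToTensor, LinearMap.coe_mk, AddHom.coe_mk, h1]
    simp only [Matrix.vecMul, dotProduct, Fin.sum_univ_four, modelY, Matrix.of_apply,
      Matrix.cons_val, mul_zero, add_zero, zero_add, mul_one, map_mul, h2,
      ← Algebra.TensorProduct.one_def]
    ring
  have hZ : ∀ q ∈ N, q * (1 ⊗ₜ X 0) ∈ N := by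
    rintro _ ⟨v, rfl⟩
    refine ⟨(X 2 : MvPolynomial (Fin 3) k) • v, ?_⟩
    have h2 : polyToTensor l (X 2) = 1 ⊗ₜ X 0 := by
      simp [polyToTensor]
    simp only [coordToTensor, LinearMap.coe_mk, AddHom.coe_mk, Pi.smul_apply, smul_eq_mul,
      map_mul, h2]
    ring
  have hX' : ∀ q ∈ N, q * (X 0 ⊗ₜ 1) ∈ N := by
    intro q hq
    have : (X 0 ⊗ₜ 1 : MvPolynomial (Fin 2) k ⊗[k] MvPolynomial (Fin 1) k) =
        (X 0 - l • X 1) ⊗ₜ 1 + l • (X 1 ⊗ₜ 1) := by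
      rw [TensorProduct.smul_tmul', ← TensorProduct.add_tmul, sub_add_cancel]
    rw [this, mul_add, mul_smul_comm]
    exact add_mem (hX q hq) (N.smul_mem l (hY q hq))
  have h1 : (1 : MvPolynomial (Fin 2) k ⊗[k] MvPolynomial (Fin 1) k) ∈ N := by
    refine ⟨![1, 0, 0, 0], ?_⟩
    simp [coordToTensor, Algebra.TensorProduct.one_def]
  have hl : ∀ (p : MvPolynomial (Fin 2) k), ∀ q ∈ N, q * (p ⊗ₜ 1) ∈ N := by
    intro p
    induction p using MvPolynomial.induction_on with
    | C c =>
      intro q hq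
      have : (C c ⊗ₜ 1 : MvPolynomial (Fin 2) k ⊗[k] MvPolynomial (Fin 1) k) = c • 1 := by
        rw [Algebra.TensorProduct.one_def, TensorProduct.smul_tmul', smul_eq_C_mul, mul_one]
      rw [this, mul_smul_comm, mul_one]
      exact N.smul_mem c hq
    | add a b ha hb =>
      intro q hq
      rw [TensorProduct.add_tmul, mul_add]
      exact add_mem (ha q hq) (hb q hq)
    | mul_X p i hp =>
      intro q hq
      have : ((p * X i) ⊗ₜ 1 : MvPolynomial (Fin 2) k ⊗[k] MvPolynomial (Fin 1) k) =
        p ⊗ₜ 1 * X i ⊗ₜ 1 := by simp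
      rw [this, ← mul_assoc]
      fin_cases i
      exacts [hX' _ (hp q hq), hY _ (hp q hq)]
  have hr : ∀ (p : MvPolynomial (Fin 1) k), ∀ q ∈ N, q * (1 ⊗ₜ p) ∈ N := by
    intro p
    induction p using MvPolynomial.induction_on with
    | C c =>
      intro q hq
      have : (1 ⊗ₜ C c : MvPolynomial (Fin 2) k ⊗[k] MvPolynomial (Fin 1) k) = c • 1 := by
        rw [Algebra.TensorProduct.one_def, ← TensorProduct.tmul_smul c (1 : MvPolynomial (Fin 2) k),
          smul_eq_C_mul, mul_one]
      rw [this, mul_smul_comm, mul_one]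
      exact N.smul_mem c hq
    | add a b ha hb =>
      intro q hq
      rw [TensorProduct.tmul_add, mul_add]
      exact add_mem (ha q hq) (hb q hq)
    | mul_X p i hp =>
      intro q hq
      have : (1 ⊗ₜ (p * X i) : MvPolynomial (Fin 2) k ⊗[k] MvPolynomial (Fin 1) k) =
        1 ⊗ₜ p * 1 ⊗ₜ X i := by simp
      rw [this, ← mul_assoc, Subsingleton.elim i 0]
      exact hZ _ (hp q hq)
  intro q
  change q ∈ N
  induction q using TensorProduct.induction_on with
  | zero => exact zero_mem _
  | tmul a b =>
    have := hr b _ (hl a 1 h1)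
    simpa using this
  | add a b ha hb => exact add_mem ha hb

variable {a c B C g h l : k}

/-- The homomorphism `k[x, y] → E`. -/
def fromXY (a c B C : k) : MvPolynomial (Fin 2) k →ₐ[k] Presented (ellipticRels a c B C) :=
  aevalOfComm ![gen (ellipticRels a c B C) 0, gen (ellipticRels a c B C) 1] <| by
    have := gen_one_mul_gen_zero a c B C
    intro i j
    fin_cases i <;> fin_cases j <;> simp [this]

/-- The homomorphism `k[z] → E`. -/
def fromZ (a c B C : k) : MvPolynomial (Fin 1) k →ₐ[k] Presented (ellipticRels a c B C) :=
  aevalOfComm (fun _ => gen (ellipticRels a c B C) 2) fun _ _ => rfl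

theorem fromXY_X_zero : fromXY a c B C (X 0) = gen (ellipticRels a c B C) 0 := aevalOfComm_X _ _ _

theorem fromXY_X_one : fromXY a c B C (X 1) = gen (ellipticRels a c B C) 1 := aevalOfComm_X _ _ _

theorem fromZ_X (i : Fin 1) : fromZ a c B C (X i) = gen (ellipticRels a c B C) 2 :=
  aevalOfComm_X _ _ _

/-- The anti-isomorphism `E → T`. -/
def ellipticReverse (hB : B = 2 - 2 * l) (hg : g = C + 2 * (a - 1) - l ^ 2)
    (hh : h = c - (a - 1) * (C + a - 1)) : Presented (ellipticRels a c B C) →ₗ[k] T g h where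
  toFun t := reverse g h (ellipticEquivT hB hg hh t)
  map_add' s t := by rw [map_add, reverse_add]
  map_smul' r t := by rw [map_smul, reverse_smul]; rfl

theorem ellipticReverse_mul (hB : B = 2 - 2 * l) (hg : g = C + 2 * (a - 1) - l ^ 2)
    (hh : h = c - (a - 1) * (C + a - 1)) (s t : Presented (ellipticRels a c B C)) :
    ellipticReverse hB hg hh (s * t) =
      ellipticReverse hB hg hh t * ellipticReverse hB hg hh s := by
  change reverse g h (ellipticEquivT hB hg hh (s * t)) = _
  rw [map_mul, reverse_mul]
  rfl

theorem ellipticReverse_one (hB : B = 2 - 2 * l) (hg : g = C + 2 * (a - 1) - l ^ 2)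
    (hh : h = c - (a - 1) * (C + a - 1)) :
    ellipticReverse hB hg hh (1 : Presented (ellipticRels a c B C)) = 1 := by
  change reverse g h (ellipticEquivT hB hg hh 1) = 1
  rw [map_one, ← map_one (algebraMap k (T g h)), reverse_algebraMap]

theorem ellipticReverse_bijective (hB : B = 2 - 2 * l) (hg : g = C + 2 * (a - 1) - l ^ 2)
    (hh : h = c - (a - 1) * (C + a - 1)) : Function.Bijective (ellipticReverse hB hg hh) :=
  reverse_involutive.bijective.comp (ellipticEquivT hB hg hh).bijective

theorem ellipticReverse_fromXY_sub (hB : B = 2 - 2 * l) (hg : g = C + 2 * (a - 1) - l ^ 2)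
    (hh : h = c - (a - 1) * (C + a - 1)) :
    ellipticReverse hB hg hh (fromXY a c B C (X 0 - l • X 1)) = x g h := by
  change reverse g h (ellipticEquivT hB hg hh _) = _
  rw [map_sub, map_smul, map_sub, map_smul, fromXY_X_zero, fromXY_X_one, ellipticEquivT_gen_zero,
    ellipticEquivT_gen_one, add_sub_cancel_right]
  exact reverse_gen 0

theorem ellipticReverse_fromXY_X_one (hB : B = 2 - 2 * l) (hg : g = C + 2 * (a - 1) - l ^ 2)
    (hh : h = c - (a - 1) * (C + a - 1)) :
    ellipticReverse hB hg hh (fromXY a c B C (X 1)) = y g h := by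
  change reverse g h (ellipticEquivT hB hg hh _) = _
  rw [fromXY_X_one, ellipticEquivT_gen_one]
  exact reverse_gen 1

theorem ellipticReverse_fromZ (hB : B = 2 - 2 * l) (hg : g = C + 2 * (a - 1) - l ^ 2)
    (hh : h = c - (a - 1) * (C + a - 1)) :
    ellipticReverse hB hg hh (fromZ a c B C (X 0)) = z g h (l - (a - 1)) := by
  change reverse g h (ellipticEquivT hB hg hh _) = _
  rw [fromZ_X, ellipticEquivT_gen_two, reverse_add, reverse_add, reverse_smul]
  change reverse g h (gen _ 2) + reverse g h (gen _ 0) + _ • reverse g h (gen _ 1) = _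
  rw [reverse_gen, reverse_gen, reverse_gen]
  rfl

/-- After reversal the multiplication map F sends p ⊗ q to a product with the z-part on the left, as
in the free-module description of T. Then F ∘ `coordToTensor` = `ofCoord` is bijective, and since
`coordToTensor` is surjective, F is bijective too. -/
theorem bijective_mul_fromXY_fromZ (hB : B = 2 - 2 * l) (hg : g = C + 2 * (a - 1) - l ^ 2)
    (hh : h = c - (a - 1) * (C + a - 1)) : Function.Bijective
      (LinearMap.mul' k (Presented (ellipticRels a c B C)) ∘ₗ
        TensorProduct.map (fromXY a c B C).toLinearMap (fromZ a c B C).toLinearMap) := by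
  set μ := LinearMap.mul' k (Presented (ellipticRels a c B C)) ∘ₗ
    TensorProduct.map (fromXY a c B C).toLinearMap (fromZ a c B C).toLinearMap with hμ
  set F := ellipticReverse hB hg hh ∘ₗ μ with hF
  have hFt : ∀ p q, F (p ⊗ₜ q) = ellipticReverse hB hg hh (fromZ a c B C q) *
      ellipticReverse hB hg hh (fromXY a c B C p) := by
    intro p q
    rw [← ellipticReverse_mul]
    rfl
  have hx := ellipticReverse_fromXY_sub hB hg hh
  have hy := ellipticReverse_fromXY_X_one hB hg hh
  have hz := ellipticReverse_fromZ hB hg hh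
  -- Under reversal x² and y² sit between the two factors or to their right; being central, they can
  -- be moved to the front. The element z is already on the left.
  have hX : ∀ i q, F (polyToTensor l (X i) * q) = polyMap g h (l - (a - 1)) (X i) * F q := by
    intro i q
    induction q using TensorProduct.induction_on with
    | zero => simp
    | add p q hp hq => rw [mul_add, map_add, hp, hq, map_add, mul_add]
    | tmul p q =>
      fin_cases i
      · change F (polyToTensor l (X 0) * _) = polyMap g h (l - (a - 1)) (X 0) * _
        rw [polyMap_X_zero]
        simp only [polyToTensor, aeval_X, Matrix.cons_val, Algebra.TensorProduct.tmul_mul_tmul,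
          one_mul, hFt]
        rw [mul_comm _ p, map_mul (fromXY a c B C), map_mul (fromXY a c B C), ellipticReverse_mul,
          ellipticReverse_mul, hx,
          ← mul_assoc, ← mul_assoc, mul_assoc _ (x g h) (x g h), (commute_x_sq _).eq, mul_assoc]
      · change F (polyToTensor l (X 1) * _) = polyMap g h (l - (a - 1)) (X 1) * _
        rw [polyMap_X_one]
        simp only [polyToTensor, aeval_X, Matrix.cons_val, Algebra.TensorProduct.tmul_mul_tmul,
          one_mul, hFt]
        rw [mul_comm _ p, map_mul (fromXY a c B C), map_mul (fromXY a c B C), ellipticReverse_mul,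
          ellipticReverse_mul, hy,
          ← mul_assoc, ← mul_assoc, mul_assoc _ (y g h) (y g h), (commute_y_sq _).eq, mul_assoc]
      · change F (polyToTensor l (X 2) * _) = polyMap g h (l - (a - 1)) (X 2) * _
        rw [polyMap_X_two]
        simp only [polyToTensor, aeval_X, Matrix.cons_val, Algebra.TensorProduct.tmul_mul_tmul,
          one_mul, hFt]
        rw [mul_comm _ q, map_mul (fromZ a c B C), ellipticReverse_mul, hz, mul_assoc]
  have hS : ∀ s q, F (polyToTensor l s * q) = polyMap g h (l - (a - 1)) s * F q := by
    intro s
    induction s using MvPolynomial.induction_on with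
    | C r =>
      intro q
      rw [polyMap_C, ← algebraMap_eq, AlgHom.commutes, ← Algebra.smul_def, ← Algebra.smul_def,
        map_smul]
    | add s t hs ht => intro q; rw [map_add, map_add, add_mul, add_mul, map_add, hs, ht]
    | mul_X s i hs => intro q; rw [map_mul (polyToTensor l), map_mul (polyMap _ _ _), mul_assoc, hs, hX, mul_assoc]
  have hν : ∀ v, F (coordToTensor l v) = ofCoord g h (l - (a - 1)) v := by
    intro v
    simp only [coordToTensor, LinearMap.coe_mk, AddHom.coe_mk, map_add, hS, hFt, map_one,
      ellipticReverse_one, map_mul, ellipticReverse_mul, hx, hy, one_mul, mul_one, ofCoord_apply,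
      y_mul_x]
  have hbij : Function.Bijective F := by
    constructor
    · rw [injective_iff_map_eq_zero]
      intro q hq
      obtain ⟨v, rfl⟩ := coordToTensor_surjective l q
      rw [hν] at hq
      have := coord_ofCoord g h (l - (a - 1)) v
      rw [hq, map_zero] at this
      rw [← this, map_zero]
    · intro t
      exact ⟨coordToTensor l (coord g h (l - (a - 1)) t), by rw [hν, ofCoord_coord]⟩
  exact (Function.Bijective.of_comp_iff' (ellipticReverse_bijective hB hg hh) μ).1 hbij

theorem map_homogeneousSubmodule_mem {σ : Type*} {rels : Set (FreeAlgebra k (Fin 3))}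
    (φ : MvPolynomial σ k →ₐ[k] Presented rels) (hφ : ∀ i, φ (X i) ∈ Set.range (gen rels)) (n : ℕ)
    (p : MvPolynomial σ k) (hp : p ∈ homogeneousSubmodule σ k n) : φ p ∈ wordGrading rels n := by
  rw [homogeneousSubmodule_eq_span_pow] at hp
  have h := Submodule.mem_map_of_mem (f := φ.toLinearMap) hp
  rw [Submodule.map_pow, Submodule.map_span, ← Set.range_comp] at h
  refine pow_le_pow_left' (Submodule.span_mono ?_) n h
  rintro _ ⟨i, rfl⟩
  exact hφ i

theorem isGradedTwistedTensorProduct (hB : B = 2 - 2 * l) (hg : g = C + 2 * (a - 1) - l ^ 2)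
    (hh : h = c - (a - 1) * (C + a - 1)) :
    IsGradedTwistedTensorProduct (homogeneousSubmodule (Fin 2) k) (homogeneousSubmodule (Fin 1) k)
      (wordGrading (ellipticRels a c B C)) (fromXY a c B C) (fromZ a c B C) where
  gradedLeft := isConnectedGraded_homogeneousSubmodule _
  gradedRight := isConnectedGraded_homogeneousSubmodule _
  graded := isConnectedGraded_wordGrading (quadraticRels_twistedRels _ _ _ _ _ _ _ _ _ _ _ _)
  left_mem := map_homogeneousSubmodule_mem _ fun i => by
    fin_cases i
    exacts [⟨0, fromXY_X_zero.symm⟩, ⟨1, fromXY_X_one.symm⟩]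
  right_mem := map_homogeneousSubmodule_mem _ fun i => ⟨2, (fromZ_X i).symm⟩
  left_injective := by
    -- Each factor embeds in the tensor product, so injectivity is inherited from the multiplication
    -- map.
    have h1 := (bijective_mul_fromXY_fromZ hB hg hh).1.comp
      (Algebra.TensorProduct.includeLeft_injective (S := k) (A := MvPolynomial (Fin 2) k)
        (B := MvPolynomial (Fin 1) k) (algebraMap k _).injective)
    intro p q hpq
    exact h1 (by simpa using hpq)
  right_injective := by
    have h1 := (bijective_mul_fromXY_fromZ hB hg hh).1.comp
      (Algebra.TensorProduct.includeRight_injective (A := MvPolynomial (Fin 2) k)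
        (B := MvPolynomial (Fin 1) k) (algebraMap k _).injective)
    intro p q hpq
    exact h1 (by simpa using hpq)
  bijective := bijective_mul_fromXY_fromZ hB hg hh

end TwistedTensorProduct

end KoszulTTP

end

/-! ### The main theorem -/

theorem theorem5p6 {k : Type u} [Field k] (char_ne_two : (2 : k) ≠ 0)
    (a c B C g h : k)
    (hg : g = C + 2 * (a - 1) - (2 - B) ^ 2 / 4)
    (hh : h = c - (a - 1) * (C + a - 1)) :
    -- the elliptic-type algebra is isomorphic to `T(g, h)` as a graded algebra
    (∃ φ : KoszulTTP.Presented (KoszulTTP.ellipticRels a c B C) ≃ₐ[k] KoszulTTP.T g h,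
      ∀ n, (KoszulTTP.wordGrading (KoszulTTP.ellipticRels a c B C) n).map φ.toLinearMap =
        KoszulTTP.gradingT g h n) ∧
    KoszulTTP.IsConnectedGraded (KoszulTTP.gradingT g h) ∧
    -- the explicit resolutions
    (h ≠ 0 → KoszulTTP.ResolutionQ g h) ∧
    (h = 0 → KoszulTTP.ResolutionP g h) ∧
    -- the Koszul property, in either presentation
    (KoszulTTP.IsKoszul (KoszulTTP.gradingT g h) ↔ h ≠ 0) ∧
    (KoszulTTP.IsKoszul (KoszulTTP.wordGrading (KoszulTTP.ellipticRels a c B C)) ↔ h ≠ 0) ∧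
    -- the algebra is a quadratic twisted tensor product of the Koszul algebras `k[x, y]`, `k[z]`
    (∃ (iR : MvPolynomial (Fin 2) k →ₐ[k] KoszulTTP.Presented (KoszulTTP.ellipticRels a c B C))
       (iS : MvPolynomial (Fin 1) k →ₐ[k] KoszulTTP.Presented (KoszulTTP.ellipticRels a c B C)),
      iR (MvPolynomial.X 0) = KoszulTTP.gen (KoszulTTP.ellipticRels a c B C) 0 ∧
      iR (MvPolynomial.X 1) = KoszulTTP.gen (KoszulTTP.ellipticRels a c B C) 1 ∧
      iS (MvPolynomial.X 0) = KoszulTTP.gen (KoszulTTP.ellipticRels a c B C) 2 ∧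
      KoszulTTP.IsGradedTwistedTensorProduct
        (MvPolynomial.homogeneousSubmodule (Fin 2) k)
        (MvPolynomial.homogeneousSubmodule (Fin 1) k)
        (KoszulTTP.wordGrading (KoszulTTP.ellipticRels a c B C)) iR iS) ∧
    KoszulTTP.IsQuadratic (KoszulTTP.wordGrading (KoszulTTP.ellipticRels a c B C)) ∧
    KoszulTTP.IsKoszul (MvPolynomial.homogeneousSubmodule (Fin 2) k) ∧
    KoszulTTP.IsKoszul (MvPolynomial.homogeneousSubmodule (Fin 1) k) := by
  -- The shift is l = (2 - B)/2; this halving is the only place where the characteristic matters.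
  have hB : B = 2 - 2 * ((2 - B) / 2) := by rw [mul_div_cancel₀ _ char_ne_two]; ring
  have hg' : g = C + 2 * (a - 1) - ((2 - B) / 2) ^ 2 := by rw [hg, div_pow]; norm_num
  have hquad : KoszulTTP.QuadraticRels (KoszulTTP.ellipticRels a c B C) :=
    KoszulTTP.quadraticRels_twistedRels _ _ _ _ _ _ _ _ _ _ _ _
  refine ⟨⟨KoszulTTP.ellipticEquivT hB hg' hh, KoszulTTP.map_ellipticEquivT hB hg' hh⟩,
    KoszulTTP.isConnectedGraded_gradingT g h, KoszulTTP.resolutionQ g h, ?_,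
    KoszulTTP.isKoszul_gradingT_iff g h, ?_,
    ⟨KoszulTTP.fromXY a c B C, KoszulTTP.fromZ a c B C, KoszulTTP.fromXY_X_zero,
      KoszulTTP.fromXY_X_one, KoszulTTP.fromZ_X 0,
      KoszulTTP.isGradedTwistedTensorProduct hB hg' hh⟩,
    KoszulTTP.isQuadratic_wordGrading hquad, KoszulTTP.isKoszul_homogeneousSubmodule_fin_two,
    KoszulTTP.isKoszul_homogeneousSubmodule_fin_one⟩
  · intro h0
    rw [h0]
    exact KoszulTTP.resolutionP g
  · rw [KoszulTTP.isKoszul_congr _ (KoszulTTP.map_ellipticEquivT hB hg' hh)]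
    exact KoszulTTP.isKoszul_gradingT_iff g h
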